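/- Let $p$ be a prime, let $F$ be a finite extension of $\mathbb{Q}_p$ with ring of integers $\mathcal{O}_F$, and let $C$ be an algebraic closure of $\mathbb{Q}_p$ with the absolute value extending the $p$-adic one, $|p|=p^{-1}$. Let $\mathcal{S}$ be the space of locally constant, compactly supported functions $\varphi: F \to C$. Fix an additive character $\psi: F\to C^\times$ such that $\mathcal{O}_F$ is its own annihilator under the pairing $\langle x,y\rangle=\psi(xy)$, that is, $\{x\in F : \psi(xy)=1 \text{ for all } y\in\mathcal{O}_F\}=\mathcal{O}_F$. Let $dx$ be the unique translation-invariant finitely additive $C$-valued distribution on the compact open subsets of $F$ giving $\mathcal{O}_F$ the volume $1$, and for $\varphi\in\mathcal{S}$ let $$\mathcal{F}(\varphi)(x)=\int_F \varphi(y)\,\psi(xy)\,dy$$ be its Fourier transform. Theorem 1. For every $\varphi\in\mathcal{S}$ there is a sequence $\varphi_n\in\mathcal{S}$ that tends to $\varphi$ uniformly on $F$ and for which $\mathcal{F}(\varphi_n)$ tends to $0$ uniformly on $F$. Equivalently (and hence also true): let $C_0(F)$ be the completion of $\mathcal{S}$ in the sup norm, i.e. the space of continuous functions on $F$ that vanish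 at infinity, with values in the completion of $C$; then the graph $\{(\varphi,\mathcal{F}(\varphi)) : \varphi\in\mathcal{S}\}$ is dense in $C_0(F)\times C_0(F)$ for the norm $\|(f_1,f_2)\|=\max\{\|f_1\|_{\sup},\|f_2\|_{\sup}\}$. -/

import Mathlib

open Filter Topology
open scoped ZeroAtInfty

namespace PadicFourier

/-- A normed field over `ℚ_[p]` is automatically non-archimedean. -/
theorem norm_add_le_max (p : ℕ) [Fact p.Prime] {F : Type*} [NormedField F] [NormedAlgebra ℚ_[p] F]
    (x y : F) : ‖x + y‖ ≤ max ‖x‖ ‖y‖ := by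
  have : IsUltrametricDist F := IsUltrametricDist.of_normedAlgebra ℚ_[p]
  exact IsUltrametricDist.norm_add_le_max x y

/-- The additive group of the ring of integers `𝒪_F = {x : |x| ≤ 1}`. -/
def integers (p : ℕ) [Fact p.Prime] (F : Type*) [NormedField F] [NormedAlgebra ℚ_[p] F] :
    AddSubgroup F where
  carrier := {x | ‖x‖ ≤ 1}
  add_mem' := fun {a b} ha hb => (norm_add_le_max p a b).trans (max_le ha hb)
  zero_mem' := by simp
  neg_mem' := fun {a} ha => by simpa using ha

/-- The open subgroup `p ^ n 𝒪_F` of `F`. -/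
def lattice (p : ℕ) [Fact p.Prime] (F : Type*) [NormedField F] [NormedAlgebra ℚ_[p] F] (n : ℕ) :
    AddSubgroup F :=
  (integers p F).map (AddMonoidHom.mulLeft ((p : F) ^ n))

/-- Schwartz functions: locally constant and compactly supported. -/
structure IsSchwartz {F C : Type*} [TopologicalSpace F] [Zero C] (φ : F → C) : Prop where
  isLocallyConstant : IsLocallyConstant φ
  hasCompactSupport : HasCompactSupport φ

/-- The Riemann sum `∑_{c ∈ F / p ^ n 𝒪_F} φ(c) vol(p ^ n 𝒪_F)`, evaluated at chosen
representatives, where `vol(p ^ n 𝒪_F) = 1 / [𝒪_F : p ^ n 𝒪_F]`. -/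
noncomputable def riemannSum (p : ℕ) [Fact p.Prime] {F C : Type*} [NormedField F]
    [NormedAlgebra ℚ_[p] F] [Field C] (φ : F → C) (n : ℕ) : C :=
  (∑ᶠ c : F ⧸ lattice p F n, φ (Quotient.out c)) / ((lattice p F n).relIndex (integers p F) : C)

/-- The integral of a Schwartz function against the `C`-valued Haar distribution on `F` giving
`𝒪_F` the volume `1`. For a Schwartz function `φ` the sequence of Riemann sums is eventually
constant (as soon as `φ` is constant on the cosets of `p ^ n 𝒪_F`), and the limit is the
eventual value. -/
noncomputable def integral (p : ℕ) [Fact p.Prime] {F C : Type*} [NormedField F]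
    [NormedAlgebra ℚ_[p] F] [NormedField C] (φ : F → C) : C :=
  limUnder atTop (riemannSum p φ)

/-- The character `ψ` makes `𝒪_F` equal to its own annihilator under `⟨x, y⟩ = ψ (x y)`. -/
def IsSelfDual (p : ℕ) [Fact p.Prime] {F C : Type*} [NormedField F] [NormedAlgebra ℚ_[p] F]
    [Field C] (ψ : AddChar F C) : Prop :=
  {x : F | ∀ y ∈ integers p F, ψ (x * y) = 1} = (integers p F : Set F)

/-- The Fourier transform `x ↦ ∫ φ(y) ψ(x y) dy`. -/
noncomputable def fourier (p : ℕ) [Fact p.Prime] {F C : Type*} [NormedField F]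
    [NormedAlgebra ℚ_[p] F] [NormedField C] (ψ : AddChar F C) (φ : F → C) (x : F) : C :=
  integral p fun y => φ y * ψ (x * y)

/-- The graph of the Fourier transform on Schwartz functions, inside `C₀(F) × C₀(F)`. Here `C₀(F)`,
the sup norm completion of the space of Schwartz functions, is the space of continuous functions
vanishing at infinity with values in the completion of `C`; the product carries the norm
`max (‖f₁‖, ‖f₂‖)`. -/
def fourierGraph (p : ℕ) [Fact p.Prime] {F C : Type*} [NormedField F]
    [NormedAlgebra ℚ_[p] F] [NormedField C] (ψ : AddChar F C) :
    Set (C₀(F, UniformSpace.Completion C) × C₀(F, UniformSpace.Completion C)) :=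
  {f | ∃ φ : F → C, IsSchwartz φ ∧ (∀ x, f.1 x = (φ x : UniformSpace.Completion C)) ∧
    ∀ x, f.2 x = ((fourier p ψ φ x : C) : UniformSpace.Completion C)}

end PadicFourier

/-!
The span of the characters `ψ(a ·)` is large in a strong sense: on a ball `p ^ (-k) 𝒪_F` every
locally constant function bounded by `δ` is uniformly approximated, to any precision, by finite sums
`∑ c_a ψ(a y)` with `|c_a| ≤ B δ`, where `B` depends neither on `k` nor on the precision
(`exists_charCombination_approx`). The function `ψ(a y)` cut off to the ball has as Fourier
transform the indicator function of a coset times the volume of the ball, a natural number divisible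
by `p ^ k` (`hasTransform_char`). So if a Schwartz function is approximated in this way on larger
and larger balls, the Fourier transforms of the approximants are bounded by `B δ p ^ (-k)` and tend
to `0` (`IsSchwartz.exists_approx_small_transform`). Since every Schwartz function `s` is the
transform of some `θ` (`IsSchwartz.exists_hasTransform`), a pair `(s₁, s₂)` is approximated by the
point of the graph over `φ + θ`, where `φ` is close to `s₁ - θ` and has small transform. This gives
the density, as Schwartz functions are dense in `C₀(F)`.

The uniform bound `B` is the heart of the matter. Approximating with an error of `p ^ (-1 / 2)` is
enough, by iteration. A locally constant function on a ball is a combination of indicator functions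
of cosets of an intersection of kernels of a fixed number of characters of finite order, so one has
to approximate the indicator function of `μ_{p ^ l}` on `μ_{p ^ (l + r)}` by a polynomial with
coefficients bounded independently of `r`; the integer `l` may be chosen
(`exists_polynomial_approx`). Let `q` be a root of unity of order `p ^ n`, `n = l + r`, and let `ℓ`
be the sum of the coefficients in the degrees divisible by `p ^ r`. The function to be approximated
is `q ^ x ↦ ℓ(X ^ x)`. Lagrange interpolation of `X ^ x` at the nodes `q ^ i`, `i < p ^ s`, writes
`ℓ(X ^ x)` as `∑ ℓ(L_i) (q ^ x) ^ i + ℓ(G B_x)`, where `G` is the product of the `X - q ^ i` and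
`B_x` is integral. The denominators of the `L_i` have norm `|p| ^ (s / p ^ (n - s))`, because each
of the `s` possible valuations of `i - j` contributes the same amount; this is `|p|` for
`s = p ^ (n - s)`. To bound the error, expand `G` in powers of `X - 1`. The powers with exponent at
least `p ^ r` contribute only multiples of `p`, since `(X - 1) ^ (p ^ r)` is congruent to
`X ^ (p ^ r) - 1` and `ℓ` kills the multiples of the latter. In the coefficients of the others fewer
than `p ^ r` of the factors `1 - q ^ i` are missing, and these missing factors account for a small
part of the product if `s` is large compared with `r`.
-/

namespace PadicFourier

/-! ### Distances between roots of unity of `p`-power order -/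

section RootsOfUnity

open Polynomial

theorem norm_eq_one_of_pow_eq_one {K : Type*} [NormedField K] {u : K} {N : ℕ} (hN : N ≠ 0)
    (hu : u ^ N = 1) : ‖u‖ = 1 := by
  have h : ‖u‖ ^ N = 1 := by rw [← norm_pow, hu, norm_one]
  exact (pow_eq_one_iff_of_nonneg (norm_nonneg _) hN).1 h

variable {K : Type*} [NormedField K] [IsUltrametricDist K]

theorem norm_pow_sub_one_le {u : K} (hu : ‖u‖ ≤ 1) (m : ℕ) : ‖u ^ m - 1‖ ≤ ‖u - 1‖ := by
  rw [← mul_geom_sum, norm_mul]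
  refine mul_le_of_le_one_right (norm_nonneg _) ?_
  refine IsUltrametricDist.norm_sum_le_of_forall_le_of_nonneg zero_le_one fun i _ => ?_
  rw [norm_pow]
  exact pow_le_one₀ (norm_nonneg _) hu

/-- If `gcd(a, N) ∣ b`, then `q ^ b` is a power of `q ^ a`, hence at least as close to `1`. -/
theorem norm_pow_sub_one_le_of_gcd_dvd {q : K} {N a b : ℕ} (hN : N ≠ 0) (hq : q ^ N = 1)
    (h : Nat.gcd a N ∣ b) : ‖q ^ b - 1‖ ≤ ‖q ^ a - 1‖ := by
  have hq1 : ‖q‖ = 1 := norm_eq_one_of_pow_eq_one hN hq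
  obtain ⟨c, rfl⟩ := h
  rcases (Nat.le_of_dvd (Nat.pos_of_ne_zero hN) (Nat.gcd_dvd_right a N)).lt_or_eq with hlt | heq
  · obtain ⟨m, -, hm⟩ := Nat.exists_mul_mod_eq_gcd hlt
    have : q ^ (a.gcd N) = (q ^ a) ^ m := by
      rw [← hm, ← pow_mul]
      conv_rhs => rw [← Nat.div_add_mod (a * m) N, pow_add, pow_mul, hq, one_pow, one_mul]
    rw [pow_mul, this, ← pow_mul]
    exact norm_pow_sub_one_le (by rw [norm_pow, hq1, one_pow]) _
  · rw [heq, pow_mul, hq, one_pow, sub_self, norm_zero]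
    exact norm_nonneg _

/-- The product of `1 - ζ` over the primitive `p ^ (n + 1)`-th roots of unity is
`Φ_{p ^ (n + 1)}(1) = p`, and its factors have the same norm. -/
theorem norm_sub_one_pow_totient {p : ℕ} [hp : Fact p.Prime] {q : K} {n : ℕ}
    (hq : IsPrimitiveRoot q (p ^ (n + 1))) :
    ‖q - 1‖ ^ (p ^ (n + 1)).totient = ‖(p : K)‖ := by
  have hN : p ^ (n + 1) ≠ 0 := pow_ne_zero _ hp.out.ne_zero
  have : NeZero (p ^ (n + 1)) := ⟨hN⟩
  rw [← eval_one_cyclotomic_prime_pow (R := K) n, cyclotomic_eq_prod_X_sub_primitiveRoots hq,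
    eval_prod, norm_prod, ← hq.card_primitiveRoots, Finset.prod_congr rfl, Finset.prod_const]
  intro ζ hζ
  have hζ' := (mem_primitiveRoots (Nat.pos_of_ne_zero hN)).1 hζ
  rw [eval_sub, eval_X, eval_C, norm_sub_rev]
  obtain ⟨i, -, hi⟩ := hq.eq_pow_of_pow_eq_one hζ'.pow_eq_one
  obtain ⟨j, -, hj⟩ := hζ'.eq_pow_of_pow_eq_one hq.pow_eq_one
  refine le_antisymm ?_ ?_
  · rw [← hi]
    exact norm_pow_sub_one_le (norm_eq_one_of_pow_eq_one hN hq.pow_eq_one).le _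
  · rw [← hj]
    exact norm_pow_sub_one_le (norm_eq_one_of_pow_eq_one hN hζ'.pow_eq_one).le _

theorem norm_sub_one_pow_totient_eq {p : ℕ} [hp : Fact p.Prime] {q : K} {s e : ℕ} {τ : ℝ}
    (hτ : 0 ≤ τ) (hτe : τ ^ p ^ e = ‖(p : K)‖) (hq : IsPrimitiveRoot q (p ^ (s + 1 + e))) :
    ‖q - 1‖ ^ (p ^ (s + 1)).totient = τ := by
  have hq' : IsPrimitiveRoot q (p ^ (s + e + 1)) := by rwa [add_right_comm] at hq
  refine (pow_left_inj₀ (pow_nonneg (norm_nonneg _) _) hτ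
    (pow_ne_zero e hp.out.ne_zero)).1 ?_
  rw [hτe, ← norm_sub_one_pow_totient hq', ← pow_mul, Nat.totient_prime_pow_succ hp.out,
    Nat.totient_prime_pow_succ hp.out, pow_add]
  congr 1
  ring

/-- For `q` of order `p ^ (s + e)`, each `p`-adic valuation `v < t` contributes the same factor
`|p| ^ (1 / p ^ e)` to this product. -/
theorem prod_norm_pow_sub_one {p : ℕ} [hp : Fact p.Prime] {e : ℕ} {τ : ℝ}
    (hτ : 0 ≤ τ) (hτe : τ ^ p ^ e = ‖(p : K)‖) (t : ℕ) :
    ∀ {s : ℕ} {q : K}, t ≤ s → IsPrimitiveRoot q (p ^ (s + e)) →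
      ∏ i ∈ Finset.range (p ^ s) with ¬ p ^ t ∣ i, ‖q ^ i - 1‖ = τ ^ t := by
  induction t with
  | zero => intro s q _ _; simp
  | succ t ih =>
    intro s q hs hq
    obtain ⟨s, rfl⟩ : ∃ s', s = s' + 1 := ⟨s - 1, by omega⟩
    have hN : p ^ (s + 1 + e) ≠ 0 := pow_ne_zero _ hp.out.ne_zero
    have hq' : IsPrimitiveRoot (q ^ p) (p ^ (s + e)) :=
      hq.pow (Nat.pos_of_ne_zero hN) (by rw [← pow_succ']; congr 1; ring)
    rw [← Finset.prod_filter_mul_prod_filter_not _ (fun i => p ∣ i), pow_succ τ t,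
      ← ih (by omega) hq', Finset.filter_filter, Finset.filter_filter]
    congr 1
    · refine (Finset.prod_nbij' (fun i => p * i) (fun i => i / p) ?_ ?_ ?_ ?_ ?_).symm
      · intro i hi
        simp only [Finset.mem_filter, Finset.mem_range] at hi ⊢
        refine ⟨?_, ?_, dvd_mul_right _ _⟩
        · rw [pow_succ']
          exact Nat.mul_lt_mul_of_pos_left hi.1 hp.out.pos
        · rw [pow_succ']
          exact fun h => hi.2 (Nat.dvd_of_mul_dvd_mul_left hp.out.pos h)
      · intro i hi
        simp only [Finset.mem_filter, Finset.mem_range] at hi ⊢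
        obtain ⟨h1, h2, c, rfl⟩ := hi
        rw [Nat.mul_div_cancel_left _ hp.out.pos]
        rw [pow_succ'] at h1 h2
        exact ⟨lt_of_mul_lt_mul_left h1 (Nat.zero_le _), fun h => h2 (Nat.mul_dvd_mul_left _ h)⟩
      · intro i _
        exact Nat.mul_div_cancel_left _ hp.out.pos
      · intro i hi
        simp only [Finset.mem_filter] at hi
        exact Nat.mul_div_cancel' hi.2.2
      · intro i _
        rw [pow_mul]
    · rw [← norm_sub_one_pow_totient_eq hτ hτe hq, Nat.totient_eq_card_coprime,
        ← Finset.prod_const]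
      refine Finset.prod_congr ?_ ?_
      · ext i
        simp only [Finset.mem_filter, Finset.mem_range, Nat.coprime_pow_left_iff (Nat.succ_pos s),
          hp.out.coprime_iff_not_dvd]
        refine and_congr_right fun _ => ⟨fun h => h.2, fun h => ⟨fun h' => h ?_, h⟩⟩
        exact (dvd_pow_self p (Nat.succ_ne_zero t)).trans h'
      · intro i hi
        simp only [Finset.mem_filter] at hi
        have hc : Nat.gcd i (p ^ (s + 1 + e)) = 1 :=
          Nat.Coprime.pow_right _ ((Nat.coprime_pow_left_iff (Nat.succ_pos s) _ _).1 hi.2).symm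
        refine le_antisymm
          (norm_pow_sub_one_le (norm_eq_one_of_pow_eq_one hN hq.pow_eq_one).le _) ?_
        simpa using norm_pow_sub_one_le_of_gcd_dvd (b := 1) hN hq.pow_eq_one (by rw [hc])

/-- The Lagrange denominators at the nodes `1, q, …, q ^ (p ^ s - 1)` all have the same norm. -/
theorem prod_norm_pow_sub_pow {p : ℕ} [hp : Fact p.Prime] {s e : ℕ} {τ : ℝ} {q : K}
    (hτ : 0 ≤ τ) (hτe : τ ^ p ^ e = ‖(p : K)‖) (hq : IsPrimitiveRoot q (p ^ (s + e)))
    {i : ℕ} (hi : i < p ^ s) :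
    ∏ j ∈ (Finset.range (p ^ s)).erase i, ‖q ^ i - q ^ j‖ = τ ^ s := by
  have hN : p ^ (s + e) ≠ 0 := pow_ne_zero _ hp.out.ne_zero
  have hq1 : ‖q‖ = 1 := norm_eq_one_of_pow_eq_one hN hq.pow_eq_one
  rw [← prod_norm_pow_sub_one hτ hτe s le_rfl hq]
  -- For `0 < d < p ^ s` the numbers `d` and `p ^ s - d` have the same `p`-adic valuation.
  have hle : ∀ d, 0 < d → d < p ^ s → ‖q ^ (p ^ s - d) - 1‖ ≤ ‖q ^ d - 1‖ := by
    intro d hd hd'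
    refine norm_pow_sub_one_le_of_gcd_dvd hN hq.pow_eq_one (Nat.dvd_sub ?_ (Nat.gcd_dvd_left _ _))
    obtain ⟨v, -, hv⟩ := (Nat.dvd_prime_pow hp.out).1 (Nat.gcd_dvd_right d (p ^ (s + e)))
    rw [hv]
    refine pow_dvd_pow _ ((Nat.pow_le_pow_iff_right hp.out.one_lt).1 ?_)
    exact (hv ▸ Nat.le_of_dvd hd (Nat.gcd_dvd_left _ _)).trans hd'.le
  have hsymm : ∀ d, 0 < d → d < p ^ s → ‖q ^ (p ^ s - d) - 1‖ = ‖q ^ d - 1‖ := by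
    intro d hd hd'
    refine le_antisymm (hle d hd hd') ?_
    simpa [Nat.sub_sub_self hd'.le] using hle (p ^ s - d) (by omega) (by omega)
  have hnd : ∀ l, l < p ^ s → (¬ p ^ s ∣ l ↔ l ≠ 0) := fun l hl =>
    not_congr ⟨fun h => Nat.eq_zero_of_dvd_of_lt h hl, fun h => h ▸ dvd_zero _⟩
  have hfil : (Finset.range (p ^ s)).filter (fun l => ¬ p ^ s ∣ l)
      = (Finset.range (p ^ s)).erase 0 := by
    ext l
    simp only [Finset.mem_filter, Finset.mem_erase, Finset.mem_range]
    constructor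
    · rintro ⟨h, h'⟩
      exact ⟨(hnd l h).1 h', h⟩
    · rintro ⟨h, h'⟩
      exact ⟨h', (hnd l h').2 h⟩
  rw [hfil]
  refine Finset.prod_nbij' (fun j => if i ≤ j then j - i else j + p ^ s - i)
    (fun l => if i + l < p ^ s then i + l else i + l - p ^ s) ?_ ?_ ?_ ?_ ?_
  · intro j hj
    simp only [Finset.mem_erase, Finset.mem_range] at hj ⊢
    split_ifs <;> omega
  · intro j hj
    simp only [Finset.mem_erase, Finset.mem_range] at hj ⊢
    split_ifs <;> omega
  · intro j hj
    simp only [Finset.mem_erase, Finset.mem_range] at hj ⊢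
    split_ifs <;> omega
  · intro j hj
    simp only [Finset.mem_erase, Finset.mem_range] at hj ⊢
    split_ifs <;> omega
  · intro j hj
    simp only [Finset.mem_erase, Finset.mem_range] at hj
    have key : ∀ a d : ℕ, ‖q ^ (a + d) - q ^ a‖ = ‖q ^ d - 1‖ := fun a d => by
      rw [pow_add, ← mul_sub_one, norm_mul, norm_pow, hq1, one_pow, one_mul]
    split_ifs with hij
    · rw [norm_sub_rev, ← key i (j - i), Nat.add_sub_cancel' hij]
    · rw [show j + p ^ s - i = p ^ s - (i - j) by omega, hsymm _ (by omega) (by omega),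
        ← key j (i - j), Nat.add_sub_cancel' (by omega)]

/-- Omitting fewer than `p ^ r` of the points costs little: the omitted ones among those of
valuation less than `s - r` contribute at least `τ`. -/
theorem prod_sdiff_norm_pow_sub_one_le {p : ℕ} [hp : Fact p.Prime] {s e r : ℕ} {τ : ℝ} {q : K}
    (hτ : 0 < τ) (hτe : τ ^ p ^ e = ‖(p : K)‖) (hq : IsPrimitiveRoot q (p ^ (s + e)))
    (hrs : r + 1 ≤ s) {S : Finset ℕ} (hS : S.card < p ^ r) :
    ∏ i ∈ Finset.range (p ^ s) \ S, ‖q ^ i - 1‖ ≤ τ ^ (s - r - 1) := by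
  have hN : p ^ (s + e) ≠ 0 := pow_ne_zero _ hp.out.ne_zero
  have hq1 : ‖q‖ = 1 := norm_eq_one_of_pow_eq_one hN hq.pow_eq_one
  have hle1 : ∀ i, ‖q ^ i - 1‖ ≤ 1 := fun i => by
    simpa [hq1, sub_eq_add_neg] using IsUltrametricDist.norm_add_le_max (q ^ i) (-1)
  set I := (Finset.range (p ^ s)).filter (fun i => ¬ p ^ (s - r) ∣ i) with hI
  have hIprod : ∏ i ∈ I, ‖q ^ i - 1‖ = τ ^ (s - r) :=
    prod_norm_pow_sub_one hτ.le hτe _ (Nat.sub_le _ _) hq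
  have hprim : IsPrimitiveRoot (q ^ p ^ (s - r - 1)) (p ^ (r + 1 + e)) :=
    hq.pow (Nat.pos_of_ne_zero hN) (by rw [← pow_add]; congr 1; omega)
  have hρ := norm_sub_one_pow_totient_eq hτ.le hτe hprim
  set ρ := ‖q ^ p ^ (s - r - 1) - 1‖ with hρ'
  have h1 : τ ≤ ∏ i ∈ I ∩ S, ‖q ^ i - 1‖ := by
    calc τ = ρ ^ (p ^ (r + 1)).totient := hρ.symm
      _ ≤ ρ ^ (I ∩ S).card := by
          refine pow_le_pow_of_le_one (norm_nonneg _) (hle1 _) ?_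
          refine (Finset.card_le_card Finset.inter_subset_right).trans (hS.le.trans ?_)
          rw [Nat.totient_prime_pow_succ hp.out]
          exact Nat.le_mul_of_pos_right _ (Nat.sub_pos_of_lt hp.out.one_lt)
      _ = ∏ i ∈ I ∩ S, ρ := by rw [Finset.prod_const]
      _ ≤ ∏ i ∈ I ∩ S, ‖q ^ i - 1‖ := by
          refine Finset.prod_le_prod (fun _ _ => norm_nonneg _) fun i hi => ?_
          have hi' : ¬ p ^ (s - r) ∣ i := (Finset.mem_filter.1 (Finset.mem_inter.1 hi).1).2
          refine norm_pow_sub_one_le_of_gcd_dvd hN hq.pow_eq_one ?_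
          obtain ⟨v, -, hv⟩ := (Nat.dvd_prime_pow hp.out).1 (Nat.gcd_dvd_right i (p ^ (s + e)))
          rw [hv]
          refine pow_dvd_pow _ ?_
          by_contra hlt
          exact hi' ((pow_dvd_pow p (by omega)).trans (hv ▸ Nat.gcd_dvd_left _ _))
  have h2 : (∏ i ∈ I \ S, ‖q ^ i - 1‖) * τ ≤ τ ^ (s - r - 1) * τ := by
    rw [← pow_succ, show s - r - 1 + 1 = s - r by omega, ← hIprod,
      ← Finset.prod_sdiff (Finset.inter_subset_left (s₁ := I) (s₂ := S)),
      Finset.sdiff_inter_self_left]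
    exact mul_le_mul_of_nonneg_left h1 (Finset.prod_nonneg fun _ _ => norm_nonneg _)
  refine le_trans ?_ (le_of_mul_le_mul_right h2 hτ)
  exact Finset.prod_le_prod_of_subset_of_le_one
    (Finset.sdiff_subset_sdiff (Finset.filter_subset _ _) le_rfl)
    (fun _ _ => norm_nonneg _) (fun i _ _ => hle1 i)

end RootsOfUnity

/-! ### A polynomial approximating the indicator function of a subgroup of roots of unity -/

section Interpolation

open Polynomial

variable {K : Type*} [NormedField K] [IsUltrametricDist K]

/-- The closed unit ball, the ring of integers of `K`. -/
def unitBall (K : Type*) [NormedField K] [IsUltrametricDist K] : Subring K where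
  carrier := {x | ‖x‖ ≤ 1}
  mul_mem' {a b} ha hb := by
    simpa using mul_le_one₀ ha (norm_nonneg b) hb
  one_mem' := by simp
  add_mem' {a b} ha hb := (IsUltrametricDist.norm_add_le_max a b).trans (max_le ha hb)
  zero_mem' := by simp
  neg_mem' {a} ha := by simpa using ha

/-- The sum of the coefficients of a polynomial in the degrees divisible by `J`. On `X ^ x` it is
the indicator function of `J ∣ x`, and it annihilates the multiples of `X ^ J - 1`. -/
noncomputable def coeffSum (K : Type*) [NormedField K] (J : ℕ) : K[X] →ₗ[K] K :=
  lsum fun j => if J ∣ j then LinearMap.id else 0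

theorem coeffSum_monomial {K : Type*} [NormedField K] (J x : ℕ) (c : K) :
    coeffSum K J (monomial x c) = if J ∣ x then c else 0 := by
  rw [coeffSum, lsum_apply, sum_monomial_index _ _ (by simp)]
  split_ifs <;> simp

theorem coeffSum_X_pow_mul {K : Type*} [NormedField K] (J : ℕ) (B : K[X]) :
    coeffSum K J (X ^ J * B) = coeffSum K J B := by
  induction B using Polynomial.induction_on' with
  | add f g hf hg => rw [mul_add, map_add, map_add, hf, hg]
  | monomial n a =>
    rw [X_pow_mul_monomial, coeffSum_monomial, coeffSum_monomial]
    simp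

theorem norm_coeffSum_le {J : ℕ} {A : K[X]} {M : ℝ} (hM : 0 ≤ M) (hA : ∀ i, ‖A.coeff i‖ ≤ M) :
    ‖coeffSum K J A‖ ≤ M := by
  rw [coeffSum, lsum_apply, Polynomial.sum]
  refine IsUltrametricDist.norm_sum_le_of_forall_le_of_nonneg hM fun i _ => ?_
  split_ifs
  · exact hA i
  · simpa using hM

theorem norm_coeffSum_map_le {J : ℕ} (A : (unitBall K)[X]) :
    ‖coeffSum K J (A.map (unitBall K).subtype)‖ ≤ 1 :=
  norm_coeffSum_le zero_le_one fun i => by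
    rw [coeff_map]
    exact (A.coeff i).2

/-- `(X - 1) ^ (p ^ r)` is congruent to `X ^ (p ^ r) - 1` modulo `p`. -/
theorem exists_X_sub_one_pow_mul_eq {R : Type*} [CommRing R] {p : ℕ} [hp : Fact p.Prime] {r m : ℕ}
    (hm : p ^ r ≤ m) (B : R[X]) :
    ∃ B' Z : R[X], (X - 1) ^ m * B = X ^ p ^ r * B' - B' - C (p : R) * Z := by
  obtain ⟨Z, hZ⟩ := exists_add_pow_prime_pow_eq hp.out (X - 1 : R[X]) 1 r
  obtain ⟨k, rfl⟩ := Nat.exists_eq_add_of_le hm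
  refine ⟨(X - 1) ^ k * B, (X - 1) * Z * ((X - 1) ^ k * B), ?_⟩
  have hX : (X : R[X]) ^ p ^ r = (X - 1) ^ p ^ r + 1 + (p : R[X]) * (X - 1) * Z := by
    simpa using hZ
  rw [pow_add, mul_assoc, hX, map_natCast]
  ring

theorem norm_coeffSum_X_sub_one_pow_mul_le {p : ℕ} [hp : Fact p.Prime] {r m : ℕ} (hm : p ^ r ≤ m)
    (B : (unitBall K)[X]) :
    ‖coeffSum K (p ^ r) ((X - 1) ^ m * B.map (unitBall K).subtype)‖ ≤ ‖(p : K)‖ := by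
  obtain ⟨B', Z, h⟩ := exists_X_sub_one_pow_mul_eq hm B
  have h' : (X - 1) ^ m * B.map (unitBall K).subtype
      = X ^ p ^ r * B'.map (unitBall K).subtype - B'.map (unitBall K).subtype
        - (p : K) • Z.map (unitBall K).subtype := by
    have := congrArg (Polynomial.map (unitBall K).subtype) h
    rw [Polynomial.map_mul, Polynomial.map_pow, Polynomial.map_sub, Polynomial.map_sub,
      Polynomial.map_sub, Polynomial.map_mul, Polynomial.map_mul, Polynomial.map_pow, map_X,
      Polynomial.map_one, map_C, map_natCast] at this
    rw [this, smul_eq_C_mul]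
  rw [h', map_sub, map_sub, coeffSum_X_pow_mul, sub_self, zero_sub, norm_neg, map_smul, norm_smul]
  exact mul_le_of_le_one_right (norm_nonneg _) (norm_coeffSum_map_le Z)

/-- If all products of the `1 - c i` with fewer than `p ^ r` factors omitted are small, then
`∏ (X - c i)` is small modulo `X ^ (p ^ r) - 1`. -/
theorem norm_coeffSum_prod_X_sub_C_mul_le {p : ℕ} [hp : Fact p.Prime] {r : ℕ} {M : ℝ}
    (T : Finset ℕ) (c : ℕ → K) (hc : ∀ i, ‖1 - c i‖ ≤ 1) (hpM : ‖(p : K)‖ ≤ M)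
    (hM : ∀ S ⊆ T, S.card < p ^ r → ∏ i ∈ T \ S, ‖1 - c i‖ ≤ M) (B : (unitBall K)[X]) :
    ‖coeffSum K (p ^ r) ((∏ i ∈ T, (X - C (c i))) * B.map (unitBall K).subtype)‖ ≤ M := by
  have hM0 : 0 ≤ M := (norm_nonneg _).trans hpM
  have h : ∏ i ∈ T, (X - C (c i)) = ∏ i ∈ T, ((X - 1) + C (1 - c i)) :=
    Finset.prod_congr rfl fun i _ => by rw [C_sub, C_1]; ring
  rw [h, Finset.prod_add, Finset.sum_mul, map_sum]
  refine IsUltrametricDist.norm_sum_le_of_forall_le_of_nonneg hM0 fun S hS => ?_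
  have hterm : (∏ i ∈ S, (X - 1 : K[X])) * (∏ i ∈ T \ S, C (1 - c i))
      * B.map (unitBall K).subtype
      = (∏ i ∈ T \ S, (1 - c i)) • ((X - 1) ^ S.card * B.map (unitBall K).subtype) := by
    rw [Finset.prod_const, smul_eq_C_mul, map_prod]
    ring
  rw [hterm, map_smul, norm_smul, norm_prod]
  rcases lt_or_ge S.card (p ^ r) with hlt | hge
  · have h1 : ‖coeffSum K (p ^ r) ((X - 1) ^ S.card * B.map (unitBall K).subtype)‖ ≤ 1 := by
      have := norm_coeffSum_map_le (J := p ^ r) ((X - 1) ^ S.card * B)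
      rwa [Polynomial.map_mul, Polynomial.map_pow, Polynomial.map_sub, map_X,
        Polynomial.map_one] at this
    exact (mul_le_of_le_one_right (Finset.prod_nonneg fun _ _ => norm_nonneg _) h1).trans
      (hM S (Finset.mem_powerset.1 hS) hlt)
  · refine (mul_le_of_le_one_left (norm_nonneg _) ?_).trans
      ((norm_coeffSum_X_sub_one_pow_mul_le hge B).trans hpM)
    exact Finset.prod_le_one (fun _ _ => norm_nonneg _) fun i _ => hc i

theorem norm_coeffSum_basis_le {J : ℕ} {T : Finset ℕ} {c : ℕ → K} (hc : ∀ i, ‖c i‖ ≤ 1) (i : ℕ) :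
    ‖coeffSum K J (Lagrange.basis T c i)‖ ≤ (∏ j ∈ T.erase i, ‖c i - c j‖)⁻¹ := by
  have h : Lagrange.basis T c i = (∏ j ∈ T.erase i, (c i - c j)⁻¹) •
      (∏ j ∈ T.erase i, (X - C (⟨c j, hc j⟩ : unitBall K))).map (unitBall K).subtype := by
    rw [Lagrange.basis, smul_eq_C_mul, map_prod, Polynomial.map_prod, ← Finset.prod_mul_distrib]
    refine Finset.prod_congr rfl fun j _ => ?_
    rw [Lagrange.basisDivisor, Polynomial.map_sub, map_X, map_C]
    rfl
  rw [h, map_smul, norm_smul, norm_prod, ← Finset.prod_inv_distrib]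
  simp only [norm_inv]
  exact mul_le_of_le_one_right (Finset.prod_nonneg fun _ _ => inv_nonneg.2 (norm_nonneg _))
    (norm_coeffSum_map_le _)

/-- The values of `coeffSum` at the powers of `X` are approximated by a combination of evaluations
at the nodes `c i`. The error comes from the multiples of `∏ (X - c i)`. -/
theorem norm_coeffSum_X_pow_sub_sum_le {p : ℕ} [hp : Fact p.Prime] {r : ℕ} {M : ℝ}
    (T : Finset ℕ) (c : ℕ → K) (hinj : Set.InjOn c T) (hc1 : ∀ i, ‖c i‖ ≤ 1)
    (hc : ∀ i, ‖1 - c i‖ ≤ 1) (hpM : ‖(p : K)‖ ≤ M)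
    (hM : ∀ S ⊆ T, S.card < p ^ r → ∏ i ∈ T \ S, ‖1 - c i‖ ≤ M) (x : ℕ) :
    ‖∑ i ∈ T, coeffSum K (p ^ r) (Lagrange.basis T c i) * c i ^ x
      - coeffSum K (p ^ r) (X ^ x)‖ ≤ M := by
  set G : (unitBall K)[X] := ∏ i ∈ T, (X - C (⟨c i, hc1 i⟩ : unitBall K)) with hG
  have hmonic : G.Monic := monic_prod_of_monic _ _ fun i _ => monic_X_sub_C _
  have hdeg : G.degree = T.card := by
    rw [degree_eq_natDegree hmonic.ne_zero, hG,
      natDegree_prod_of_monic _ _ fun i _ => monic_X_sub_C _]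
    simp
  have hGmap : G.map (unitBall K).subtype = ∏ i ∈ T, (X - C (c i)) := by
    rw [hG, Polynomial.map_prod]
    refine Finset.prod_congr rfl fun j _ => ?_
    rw [Polynomial.map_sub, map_X, map_C]
    rfl
  set R := ((X ^ x : (unitBall K)[X]) %ₘ G).map (unitBall K).subtype with hR
  set B := (X ^ x : (unitBall K)[X]) /ₘ G with hB
  have hXx : (X ^ x : K[X]) = R + (∏ i ∈ T, (X - C (c i))) * B.map (unitBall K).subtype := by
    rw [hR, ← hGmap, ← Polynomial.map_mul, ← Polynomial.map_add, hB, modByMonic_add_div,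
      Polynomial.map_pow, map_X]
  have hRdeg : R.degree < T.card :=
    (degree_map_le).trans_lt (hdeg ▸ degree_modByMonic_lt _ hmonic)
  have hReval : ∀ i ∈ T, R.eval (c i) = c i ^ x := fun i hi => by
    have := congrArg (eval (c i)) hXx
    rw [eval_pow, eval_X, eval_add, eval_mul, eval_prod,
      Finset.prod_eq_zero hi (by simp), zero_mul, add_zero] at this
    exact this.symm
  have hRsum : coeffSum K (p ^ r) R
      = ∑ i ∈ T, coeffSum K (p ^ r) (Lagrange.basis T c i) * c i ^ x := by
    conv_lhs => rw [Lagrange.eq_interpolate hinj hRdeg, Lagrange.interpolate_apply, map_sum]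
    refine Finset.sum_congr rfl fun i hi => ?_
    rw [hReval i hi, C_mul', map_smul, smul_eq_mul, mul_comm]
  rw [← hRsum, hXx, map_add, sub_add_cancel_left, norm_neg]
  exact norm_coeffSum_prod_X_sub_C_mul_le T c hc hpM hM B

open Classical in
/-- The indicator function of `μ_{p ^ l}` on `μ_{p ^ (l + r)}` is approximated, for a suitable `l`,
by a polynomial whose coefficients are bounded by `p` independently of `r`. -/
theorem exists_polynomial_approx (p : ℕ) [hp : Fact p.Prime] (hpK : ‖(p : K)‖ = (p : ℝ)⁻¹)
    (hroots : ∀ n, ∃ q : K, IsPrimitiveRoot q (p ^ n)) (r : ℕ) :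
    ∃ (l : ℕ) (P : K[X]), (∀ i, ‖P.coeff i‖ ≤ p) ∧ ∀ u : K, u ^ p ^ (l + r) = 1 →
      ‖P.eval u - if u ^ p ^ l = 1 then 1 else 0‖ ≤ √(p : ℝ)⁻¹ := by
  have hp0 : (0 : ℝ) < (p : ℝ)⁻¹ := inv_pos.2 (Nat.cast_pos.2 hp.out.pos)
  have hp1 : (p : ℝ)⁻¹ ≤ 1 := inv_le_one_of_one_le₀ (Nat.one_le_cast.2 hp.out.one_le)
  -- With `s = p ^ e` the Lagrange denominators have norm exactly `1 / p`.
  obtain ⟨e, he⟩ : ∃ e, 2 * r + 2 ≤ p ^ e := ⟨2 * r + 2, (Nat.lt_pow_self hp.out.one_lt).le⟩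
  set s := p ^ e with hs
  set τ : ℝ := ((p : ℝ)⁻¹) ^ ((s : ℝ)⁻¹) with hτdef
  have hτ : 0 < τ := Real.rpow_pos_of_pos hp0 _
  have hτ1 : τ ≤ 1 := Real.rpow_le_one hp0.le hp1 (by positivity)
  have hτs : τ ^ s = (p : ℝ)⁻¹ :=
    Real.rpow_inv_natCast_pow hp0.le (pow_ne_zero _ hp.out.ne_zero)
  have hτe : τ ^ p ^ e = ‖(p : K)‖ := by rw [← hs, hτs, hpK]
  obtain ⟨q, hq⟩ := hroots (s + e)
  have hN : p ^ (s + e) ≠ 0 := pow_ne_zero _ hp.out.ne_zero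
  have : NeZero (p ^ (s + e)) := ⟨hN⟩
  have hq1 : ‖q‖ = 1 := norm_eq_one_of_pow_eq_one hN hq.pow_eq_one
  have hqi : ∀ i, ‖q ^ i‖ ≤ 1 := fun i => by rw [norm_pow, hq1, one_pow]
  have hqi' : ∀ i, ‖1 - q ^ i‖ ≤ 1 := fun i => by
    simpa [hq1, sub_eq_add_neg] using IsUltrametricDist.norm_add_le_max 1 (-q ^ i)
  set T := Finset.range (p ^ s) with hT
  have hinj : Set.InjOn (fun i => q ^ i) T := by
    intro i hi j hj hij
    have hlt : p ^ s ≤ p ^ (s + e) := Nat.pow_le_pow_right hp.out.pos (Nat.le_add_right _ _)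
    simp only [hT, Finset.coe_range, Set.mem_Iio] at hi hj
    exact hq.pow_inj (hi.trans_le hlt) (hj.trans_le hlt) hij
  have hsmall : ∀ S ⊆ T, S.card < p ^ r → ∏ i ∈ T \ S, ‖1 - q ^ i‖ ≤ √(p : ℝ)⁻¹ := by
    intro S _ hS
    simp only [norm_sub_rev (1 : K)]
    refine (prod_sdiff_norm_pow_sub_one_le hτ hτe hq (by omega) hS).trans ?_
    refine Real.le_sqrt_of_sq_le ?_
    rw [← pow_mul, ← hτs]
    exact pow_le_pow_of_le_one hτ.le hτ1 (by omega)
  have hpM : ‖(p : K)‖ ≤ √(p : ℝ)⁻¹ := by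
    rw [hpK]
    exact Real.le_sqrt_of_sq_le (by nlinarith)
  have hrs : s + e - r + r = s + e := by omega
  refine ⟨s + e - r, ∑ i ∈ T, C (coeffSum K (p ^ r) (Lagrange.basis T (fun i => q ^ i) i)) * X ^ i,
    fun i => ?_, fun u hu => ?_⟩
  · rw [finsetSum_coeff]
    refine IsUltrametricDist.norm_sum_le_of_forall_le_of_nonneg (Nat.cast_nonneg p) fun j hj => ?_
    rw [coeff_C_mul_X_pow]
    split_ifs
    · refine (norm_coeffSum_basis_le hqi j).trans ?_
      rw [prod_norm_pow_sub_pow hτ.le hτe hq (Finset.mem_range.1 hj), hτs, inv_inv]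
    · simp
  · rw [hrs] at hu
    obtain ⟨x, -, rfl⟩ := hq.eq_pow_of_pow_eq_one hu
    have hiff : (q ^ x) ^ p ^ (s + e - r) = 1 ↔ p ^ r ∣ x := by
      have hsplit : p ^ (s + e) = p ^ r * p ^ (s + e - r) := by
        rw [← pow_add]
        congr 1
        omega
      rw [← pow_mul, hq.pow_eq_one_iff_dvd, hsplit,
        Nat.mul_dvd_mul_iff_right (pow_pos hp.out.pos _)]
    have hX : coeffSum K (p ^ r) (X ^ x) = if p ^ r ∣ x then 1 else 0 := by
      rw [← monomial_one_right_eq_X_pow, coeffSum_monomial]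
    have := norm_coeffSum_X_pow_sub_sum_le T (fun i => q ^ i) hinj hqi hqi' hpM hsmall x
    rw [hX] at this
    simp only [hiff, eval_finsetSum, eval_mul, eval_C, eval_pow, eval_X]
    simpa only [← pow_mul, mul_comm x] using this

end Interpolation

/-! ### Balls and lattices -/

section Balls

variable (p : ℕ) [hp : Fact p.Prime] {F : Type*} [NormedField F] [NormedAlgebra ℚ_[p] F]

theorem norm_natCast_prime (F : Type*) [NormedField F] [NormedAlgebra ℚ_[p] F] :
    ‖(p : F)‖ = (p : ℝ)⁻¹ := by
  rw [← map_natCast (algebraMap ℚ_[p] F) p, norm_algebraMap', Padic.norm_p]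

theorem natCast_prime_ne_zero (F : Type*) [NormedField F] [NormedAlgebra ℚ_[p] F] :
    (p : F) ≠ 0 := by
  rw [← norm_ne_zero_iff, norm_natCast_prime p F]
  exact inv_ne_zero (Nat.cast_ne_zero.2 hp.out.ne_zero)

theorem cast_prime_pow_pos (k : ℕ) : (0 : ℝ) < (p : ℝ) ^ k :=
  pow_pos (Nat.cast_pos.2 hp.out.pos) k

theorem one_le_cast_prime_pow (k : ℕ) : (1 : ℝ) ≤ (p : ℝ) ^ k :=
  one_le_pow₀ (Nat.one_le_cast.2 hp.out.one_le)

variable (F) in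
/-- The ball `p ^ (-k) 𝒪_F` of radius `p ^ k`. -/
def ball (k : ℕ) : AddSubgroup F where
  carrier := {x | ‖x‖ ≤ (p : ℝ) ^ k}
  add_mem' := fun {a b} ha hb => (norm_add_le_max p a b).trans (max_le ha hb)
  zero_mem' := by simp
  neg_mem' := fun {a} ha => by simpa using ha

theorem mem_ball {k : ℕ} {x : F} : x ∈ ball p F k ↔ ‖x‖ ≤ (p : ℝ) ^ k := Iff.rfl

theorem mem_integers {x : F} : x ∈ integers p F ↔ ‖x‖ ≤ 1 := Iff.rfl

theorem mem_lattice {n : ℕ} {x : F} : x ∈ lattice p F n ↔ ‖x‖ ≤ ((p : ℝ) ^ n)⁻¹ := by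
  have hpn : (p : F) ^ n ≠ 0 := pow_ne_zero _ (natCast_prime_ne_zero p F)
  have hnorm : ‖(p : F) ^ n‖ = ((p : ℝ) ^ n)⁻¹ := by
    rw [norm_pow, norm_natCast_prime, inv_pow]
  constructor
  · rintro ⟨y, hy, rfl⟩
    have hy' : ‖y‖ ≤ 1 := hy
    rw [AddMonoidHom.coe_mulLeft, norm_mul, hnorm]
    exact mul_le_of_le_one_right (inv_nonneg.2 (cast_prime_pow_pos p n).le) hy'
  · intro hx
    refine ⟨((p : F) ^ n)⁻¹ * x, ?_, ?_⟩
    · change ‖((p : F) ^ n)⁻¹ * x‖ ≤ 1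
      rw [norm_mul, norm_inv, hnorm, inv_inv]
      calc (p : ℝ) ^ n * ‖x‖ ≤ (p : ℝ) ^ n * ((p : ℝ) ^ n)⁻¹ :=
            mul_le_mul_of_nonneg_left hx (cast_prime_pow_pos p n).le
        _ = 1 := mul_inv_cancel₀ (cast_prime_pow_pos p n).ne'
    · rw [AddMonoidHom.coe_mulLeft, mul_inv_cancel_left₀ hpn]

theorem lattice_le_integers (n : ℕ) : lattice p F n ≤ integers p F := fun _ hx =>
  ((mem_lattice p).1 hx).trans (inv_le_one_of_one_le₀ (one_le_cast_prime_pow p n))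

theorem integers_le_ball (k : ℕ) : integers p F ≤ ball p F k := fun _ hx =>
  ((mem_integers p).1 hx).trans (one_le_cast_prime_pow p k)

theorem isOpen_lattice (n : ℕ) : IsOpen (lattice p F n : Set F) := by
  refine AddSubgroup.isOpen_of_mem_nhds (g := 0) _ ?_
  filter_upwards [Metric.closedBall_mem_nhds (0 : F) (inv_pos.2 (cast_prime_pow_pos p n))]
    with x hx
  exact (mem_lattice p).2 (mem_closedBall_zero_iff.1 hx)

theorem exists_lattice_subset_of_mem_nhds {s : Set F} (hs : s ∈ 𝓝 (0 : F)) :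
    ∃ n, (lattice p F n : Set F) ⊆ s := by
  obtain ⟨ε, hε, hs⟩ := Metric.mem_nhds_iff.1 hs
  obtain ⟨n, hn⟩ := exists_pow_lt_of_lt_one hε
    (inv_lt_one_of_one_lt₀ (Nat.one_lt_cast.2 hp.out.one_lt) : (p : ℝ)⁻¹ < 1)
  refine ⟨n, fun x hx => hs ?_⟩
  rw [mem_ball_zero_iff]
  rw [inv_pow] at hn
  exact ((mem_lattice p).1 hx).trans_lt hn

theorem lattice_antitone {m n : ℕ} (h : m ≤ n) : lattice p F n ≤ lattice p F m := fun _ hx =>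
  (mem_lattice p).2 (((mem_lattice p).1 hx).trans (inv_anti₀ (cast_prime_pow_pos p m)
    (pow_le_pow_right₀ (Nat.one_le_cast.2 hp.out.one_le) h)))

theorem exists_le_cast_prime_pow (R : ℝ) : ∃ k : ℕ, R ≤ (p : ℝ) ^ k :=
  (pow_unbounded_of_one_lt R (Nat.one_lt_cast.2 hp.out.one_lt)).imp fun _ h => h.le

/-- The volume `[p ^ (-k) 𝒪_F : 𝒪_F]` of the ball is divisible by `p ^ k`, the order of the class of
`p ^ (-k)`. -/
theorem pow_dvd_relIndex_integers_ball (k : ℕ) :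
    p ^ k ∣ (integers p F).relIndex (ball p F k) := by
  rcases k with _ | k
  · simp
  have hp0 := natCast_prime_ne_zero p F
  have hnorm : ∀ n : ℕ, ‖((p : F) ^ n)⁻¹‖ = (p : ℝ) ^ n := fun n => by
    rw [norm_inv, norm_pow, norm_natCast_prime, inv_pow, inv_inv]
  let x : ball p F (k + 1) := ⟨((p : F) ^ (k + 1))⁻¹, (hnorm _).le⟩
  have hx : addOrderOf (x : ball p F (k + 1) ⧸ (integers p F).addSubgroupOf (ball p F (k + 1)))
      = p ^ (k + 1) := by
    have hsmul : ∀ m : ℕ, (m • (x : ball p F (k + 1) ⧸ (integers p F).addSubgroupOf _) = 0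
        ↔ ‖(m : F) * ((p : F) ^ (k + 1))⁻¹‖ ≤ 1) := fun m => by
      rw [← QuotientAddGroup.mk_nsmul, QuotientAddGroup.eq_zero_iff,
        AddSubgroup.mem_addSubgroupOf, mem_integers, AddSubgroup.coe_nsmul, nsmul_eq_mul]
    refine addOrderOf_eq_prime_pow ?_ ?_
    · rw [hsmul, Nat.cast_pow, pow_succ, mul_inv, mul_inv_cancel_left₀ (pow_ne_zero _ hp0),
        norm_inv, norm_natCast_prime, inv_inv, not_le]
      exact Nat.one_lt_cast.2 hp.out.one_lt
    · rw [hsmul, Nat.cast_pow, mul_inv_cancel₀ (pow_ne_zero _ hp0), norm_one]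
  rw [← hx]
  exact addOrderOf_dvd_natCard _

theorem coe_map_mk_ball (n k : ℕ) :
    ((ball p F k).map (QuotientAddGroup.mk' (lattice p F n)) : Set (F ⧸ lattice p F n))
      = {c : F ⧸ lattice p F n | Quotient.out c ∈ ball p F k} := by
  have hle : lattice p F n ≤ ball p F k := (lattice_le_integers p n).trans (integers_le_ball p k)
  ext c
  constructor
  · rintro ⟨y, hy, rfl⟩
    obtain ⟨h, hh⟩ := QuotientAddGroup.mk_out_eq_add (lattice p F n) y
    change Quotient.out (y : F ⧸ lattice p F n) ∈ ball p F k
    rw [hh]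
    exact add_mem hy (hle h.2)
  · intro hc
    exact ⟨_, hc, Quotient.out_eq' c⟩

theorem ncard_out_mem_ball (n k : ℕ) :
    {c : F ⧸ lattice p F n | Quotient.out c ∈ ball p F k}.ncard
      = (lattice p F n).relIndex (ball p F k) := by
  rw [← coe_map_mk_ball p n k]
  have := AddSubgroup.relIndex_ker (ball p F k) (QuotientAddGroup.mk' (lattice p F n))
  rw [QuotientAddGroup.ker_mk'] at this
  exact this.symm

variable [ProperSpace F]

theorem isCompact_ball (k : ℕ) : IsCompact (ball p F k : Set F) := by
  have h : (ball p F k : Set F) = Metric.closedBall 0 ((p : ℝ) ^ k) := by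
    ext x
    rw [mem_closedBall_zero_iff]
    rfl
  rw [h]
  exact isCompact_closedBall _ _

/-- The image of a ball in the quotient by a lattice is finite. -/
theorem relIndex_lattice_ball_ne_zero (n k : ℕ) : (lattice p F n).relIndex (ball p F k) ≠ 0 := by
  have : CompactSpace (ball p F k) := isCompact_iff_compactSpace.1 (isCompact_ball p k)
  have : Finite (ball p F k ⧸ (lattice p F n).addSubgroupOf (ball p F k)) :=
    AddSubgroup.quotient_finite_of_isOpen _
      ((isOpen_lattice p n).preimage continuous_subtype_val)
  exact AddSubgroup.index_ne_zero_of_finite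

theorem relIndex_integers_ball_ne_zero (k : ℕ) : (integers p F).relIndex (ball p F k) ≠ 0 :=
  fun h => relIndex_lattice_ball_ne_zero p (F := F) 0 k <| by
    rw [← AddSubgroup.relIndex_mul_relIndex _ _ _ (lattice_le_integers p 0)
      (integers_le_ball p k), h, mul_zero]

theorem finite_out_mem_ball (n k : ℕ) :
    {c : F ⧸ lattice p F n | Quotient.out c ∈ ball p F k}.Finite := by
  rw [← coe_map_mk_ball p n k]
  have := AddSubgroup.relIndex_ker (ball p F k) (QuotientAddGroup.mk' (lattice p F n))
  rw [QuotientAddGroup.ker_mk'] at this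
  exact Nat.finite_of_card_ne_zero (this ▸ relIndex_lattice_ball_ne_zero p n k)

end Balls

/-! ### Schwartz functions and the additive character -/

section Schwartz

variable {p : ℕ} [hp : Fact p.Prime] {F : Type*} [NormedField F] [NormedAlgebra ℚ_[p] F]
  {C : Type*} [NormedField C]

theorem IsSchwartz.of_forall_norm_lt [ProperSpace F] {f : F → C} (hf : IsLocallyConstant f) (R : ℝ)
    (h : ∀ x, R < ‖x‖ → f x = 0) : IsSchwartz f := by
  refine ⟨hf, HasCompactSupport.intro (isCompact_closedBall (0 : F) R) fun x hx => h x ?_⟩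
  simpa using hx

variable (p) in
theorem IsSchwartz.exists_eq_zero {f : F → C} (hf : IsSchwartz f) :
    ∃ k₀ : ℕ, ∀ k ≥ k₀, ∀ x ∉ ball p F k, f x = 0 := by
  obtain ⟨R, hR⟩ := hf.hasCompactSupport.isCompact.isBounded.exists_norm_le
  obtain ⟨k, hk⟩ := exists_le_cast_prime_pow p R
  refine ⟨k, fun m hm x hx => ?_⟩
  by_contra hne
  exact hx ((hR x (subset_tsupport _ hne)).trans
    (hk.trans (pow_le_pow_right₀ (Nat.one_le_cast.2 hp.out.one_le) hm)))

theorem IsSchwartz.add {f g : F → C} (hf : IsSchwartz f) (hg : IsSchwartz g) :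
    IsSchwartz (f + g) :=
  ⟨hf.1.add hg.1, hf.2.add hg.2⟩

theorem IsSchwartz.exists_norm_le {f : F → C} (hf : IsSchwartz f) :
    ∃ δ, 0 ≤ δ ∧ ∀ x, ‖f x‖ ≤ δ := by
  obtain ⟨δ, hδ⟩ := hf.2.exists_bound_of_continuous hf.1.continuous
  exact ⟨δ, (norm_nonneg _).trans (hδ 0), hδ⟩

theorem isLocallyConstant_indicator_coset (H : AddSubgroup F) (hH : IsOpen (H : Set F)) (a : F)
    {f : F → C} (hf : IsLocallyConstant f) :
    IsLocallyConstant fun x => (H : Set F).indicator f (x + a) := by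
  rw [IsLocallyConstant.iff_eventually_eq] at hf ⊢
  intro x
  have hc : Tendsto (fun y : F => y + a) (𝓝 x) (𝓝 (x + a)) :=
    (continuous_id.add continuous_const).tendsto x
  have h1 : ∀ᶠ y in 𝓝 x, y - x ∈ H := by
    have : Tendsto (fun y : F => y - x) (𝓝 x) (𝓝 0) := by
      simpa using (continuous_id.sub continuous_const).tendsto (x := x) (f := fun y : F => y - x)
    exact this (hH.mem_nhds (zero_mem H))
  filter_upwards [h1, hc.eventually (hf (x + a))] with y hy hy'
  have hiff : y + a ∈ (H : Set F) ↔ x + a ∈ (H : Set F) := by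
    change y + a ∈ H ↔ x + a ∈ H
    rw [show y + a = (y - x) + (x + a) by ring, H.add_mem_cancel_left hy]
  by_cases hx : x + a ∈ (H : Set F)
  · rw [Set.indicator_of_mem hx, Set.indicator_of_mem (hiff.2 hx), hy']
  · rw [Set.indicator_of_notMem hx, Set.indicator_of_notMem (mt hiff.1 hx)]

variable {ψ : AddChar F C}

theorem IsSelfDual.map_eq_one (hψ : IsSelfDual p ψ) {x : F} (hx : ‖x‖ ≤ 1) : ψ x = 1 := by
  have : x ∈ {x : F | ∀ y ∈ integers p F, ψ (x * y) = 1} := by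
    rw [hψ]
    exact hx
  simpa using this 1 ((mem_integers p).2 norm_one.le)

/-- The annihilator of `p ^ (-k) 𝒪_F` is `p ^ k 𝒪_F`. -/
theorem IsSelfDual.mem_lattice_iff (hψ : IsSelfDual p ψ) {k : ℕ} {x : F} :
    x ∈ lattice p F k ↔ ∀ y ∈ ball p F k, ψ (x * y) = 1 := by
  have hnorm : ‖((p : F) ^ k)⁻¹‖ = (p : ℝ) ^ k := by
    rw [norm_inv, norm_pow, norm_natCast_prime, inv_pow, inv_inv]
  rw [mem_lattice]
  constructor
  · intro hx y hy
    refine hψ.map_eq_one ?_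
    rw [norm_mul]
    calc ‖x‖ * ‖y‖ ≤ ((p : ℝ) ^ k)⁻¹ * (p : ℝ) ^ k :=
          mul_le_mul hx hy (norm_nonneg _) (inv_nonneg.2 (cast_prime_pow_pos p k).le)
      _ = 1 := inv_mul_cancel₀ (cast_prime_pow_pos p k).ne'
  · intro h
    have hmem : x * ((p : F) ^ k)⁻¹ ∈ {x : F | ∀ y ∈ integers p F, ψ (x * y) = 1} := by
      intro y hy
      rw [mul_assoc]
      refine h _ ?_
      rw [mem_ball, norm_mul, hnorm]
      exact mul_le_of_le_one_right (cast_prime_pow_pos p k).le hy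
    rw [hψ] at hmem
    have hmem' : ‖x * ((p : F) ^ k)⁻¹‖ ≤ 1 := hmem
    rw [norm_mul, hnorm] at hmem'
    rwa [← one_div, le_div_iff₀ (cast_prime_pow_pos p k)]

/-- Every value of `ψ` is a root of unity of `p`-power order. -/
theorem IsSelfDual.pow_eq_one (hψ : IsSelfDual p ψ) {x : F} {n : ℕ} (hx : ‖x‖ ≤ (p : ℝ) ^ n) :
    ψ x ^ p ^ n = 1 := by
  rw [← AddChar.map_nsmul_eq_pow]
  refine hψ.map_eq_one ?_
  rw [nsmul_eq_mul, norm_mul, Nat.cast_pow, norm_pow, norm_natCast_prime, inv_pow,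
    inv_mul_le_iff₀ (cast_prime_pow_pos p n), mul_one]
  exact hx

theorem IsSelfDual.norm_eq_one (hψ : IsSelfDual p ψ) (x : F) : ‖ψ x‖ = 1 := by
  obtain ⟨n, hn⟩ := exists_le_cast_prime_pow p ‖x‖
  exact norm_eq_one_of_pow_eq_one (pow_ne_zero _ hp.out.ne_zero) (hψ.pow_eq_one hn)

theorem IsSelfDual.isLocallyConstant (hψ : IsSelfDual p ψ) (a : F) :
    IsLocallyConstant fun y => ψ (a * y) := by
  rw [IsLocallyConstant.iff_eventually_eq]
  intro x
  have hc : Tendsto (fun y : F => ‖a * (y - x)‖) (𝓝 x) (𝓝 0) := by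
    have : Continuous fun y : F => ‖a * (y - x)‖ := by fun_prop
    simpa using this.tendsto x
  filter_upwards [hc.eventually (ge_mem_nhds zero_lt_one)] with y hy
  have h : a * y = a * x + a * (y - x) := by ring
  rw [h, AddChar.map_add_eq_mul, hψ.map_eq_one hy, mul_one]

end Schwartz

/-! ### Fourier transforms of test functions -/

section Transform

variable {p : ℕ} [hp : Fact p.Prime] {F : Type*} [NormedField F] [NormedAlgebra ℚ_[p] F]
  {C : Type*} [NormedField C] {ψ : AddChar F C}

variable (p) in
/-- `g` is the Fourier transform of the Schwartz function `φ`, and is itself a Schwartz function.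
Convergence of the Riemann sums is part of the definition. -/
structure HasTransform (ψ : AddChar F C) (φ g : F → C) : Prop where
  isSchwartz : IsSchwartz φ
  isSchwartz_transform : IsSchwartz g
  tendsto : ∀ x, Tendsto (riemannSum p fun y => φ y * ψ (x * y)) atTop (𝓝 (g x))

theorem HasTransform.fourier_eq {φ g : F → C} (h : HasTransform p ψ φ g) : fourier p ψ φ = g :=
  funext fun x => (h.tendsto x).limUnder_eq

theorem hasTransform_zero : HasTransform p ψ (0 : F → C) 0 := by
  have h0 : IsSchwartz (0 : F → C) := ⟨IsLocallyConstant.const 0, HasCompactSupport.zero⟩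
  refine ⟨h0, h0, fun x => ?_⟩
  have : riemannSum p (fun y : F => (0 : F → C) y * ψ (x * y)) = fun _ => 0 := by
    funext n
    simp [riemannSum]
  rw [this]
  exact tendsto_const_nhds

theorem norm_relIndex_integers_ball_le [NormedAlgebra ℚ_[p] C] (k : ℕ) :
    ‖((integers p F).relIndex (ball p F k) : C)‖ ≤ ((p : ℝ) ^ k)⁻¹ := by
  obtain ⟨m, hm⟩ := pow_dvd_relIndex_integers_ball p (F := F) k
  have := IsUltrametricDist.of_normedAlgebra ℚ_[p] (L := C)
  rw [hm, Nat.cast_mul, norm_mul, Nat.cast_pow, norm_pow, norm_natCast_prime, inv_pow]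
  exact mul_le_of_le_one_right (inv_nonneg.2 (cast_prime_pow_pos p k).le)
    (IsUltrametricDist.norm_natCast_le_one C m)

/-- A character that is nontrivial on a ball sums to zero over it. -/
theorem finsum_char_of_notMem (hψ : IsSelfDual p ψ) {n k : ℕ} {b : F}
    (hbn : ∀ y ∈ lattice p F n, ψ (b * y) = 1) (hb : b ∉ lattice p F k) :
    ∑ᶠ c : F ⧸ lattice p F n,
      (ball p F k : Set F).indicator (fun y => ψ (b * y)) (Quotient.out c) = 0 := by
  have hle : lattice p F n ≤ ball p F k := (lattice_le_integers p n).trans (integers_le_ball p k)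
  obtain ⟨z, hz, hz1⟩ : ∃ z ∈ ball p F k, ψ (b * z) ≠ 1 := by
    rw [hψ.mem_lattice_iff] at hb
    push Not at hb
    exact hb
  set f : F → C := (ball p F k : Set F).indicator (fun y => ψ (b * y)) with hf
  have hf_add : ∀ y w, w ∈ ball p F k → f (y + w) = ψ (b * w) * f y := fun y w hw => by
    have hiff : y + w ∈ (ball p F k : Set F) ↔ y ∈ (ball p F k : Set F) :=
      (ball p F k).add_mem_cancel_right hw
    by_cases hy : y ∈ (ball p F k : Set F)
    · rw [hf, Set.indicator_of_mem hy, Set.indicator_of_mem (hiff.2 hy), mul_add,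
        AddChar.map_add_eq_mul, mul_comm]
    · rw [hf, Set.indicator_of_notMem hy, Set.indicator_of_notMem (mt hiff.1 hy), mul_zero]
  have hf_out : ∀ y : F, f (Quotient.out (y : F ⧸ lattice p F n)) = f y := fun y => by
    obtain ⟨w, hw⟩ := QuotientAddGroup.mk_out_eq_add (lattice p F n) y
    rw [hw, hf_add _ _ (hle w.2), hbn _ w.2, one_mul]
  have hinv : ψ (b * z) * ∑ᶠ c : F ⧸ lattice p F n, f (Quotient.out c)
      = ∑ᶠ c : F ⧸ lattice p F n, f (Quotient.out c) := by
    rw [mul_finsum]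
    conv_rhs => rw [← finsum_comp_equiv (Equiv.addRight (z : F ⧸ lattice p F n))]
    refine finsum_congr fun c => ?_
    obtain ⟨y, rfl⟩ := QuotientAddGroup.mk_surjective c
    rw [Equiv.coe_addRight]
    beta_reduce
    rw [← QuotientAddGroup.mk_add, hf_out, hf_out, hf_add _ _ hz]
  have : (ψ (b * z) - 1) * ∑ᶠ c : F ⧸ lattice p F n, f (Quotient.out c) = 0 := by
    rw [sub_mul, one_mul, hinv, sub_self]
  exact (mul_eq_zero.1 this).resolve_left (sub_ne_zero.2 hz1)

variable [ProperSpace F]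

theorem IsSchwartz.hasFiniteSupport_out {f : F → C} (hf : IsSchwartz f) (g : F → C) (n : ℕ) :
    Function.HasFiniteSupport
      fun c : F ⧸ lattice p F n => f (Quotient.out c) * g (Quotient.out c) := by
  obtain ⟨k, hk⟩ := hf.exists_eq_zero p
  refine (finite_out_mem_ball p n k).subset fun c hc => ?_
  by_contra hne
  exact hc (by simp only [hk k le_rfl _ hne, zero_mul])

theorem HasTransform.add {φ₁ g₁ φ₂ g₂ : F → C} (h₁ : HasTransform p ψ φ₁ g₁)
    (h₂ : HasTransform p ψ φ₂ g₂) : HasTransform p ψ (φ₁ + φ₂) (g₁ + g₂) := by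
  refine ⟨h₁.1.add h₂.1, h₁.2.add h₂.2, fun x => ?_⟩
  have : riemannSum p (fun y : F => (φ₁ + φ₂) y * ψ (x * y))
      = fun n => riemannSum p (fun y => φ₁ y * ψ (x * y)) n
        + riemannSum p (fun y => φ₂ y * ψ (x * y)) n := by
    funext n
    rw [riemannSum, riemannSum, riemannSum, ← add_div,
      ← finsum_add_distrib (h₁.1.hasFiniteSupport_out (fun y => ψ (x * y)) n)
        (h₂.1.hasFiniteSupport_out (fun y => ψ (x * y)) n)]
    simp only [Pi.add_apply, add_mul]
  rw [this]
  exact (h₁.tendsto x).add (h₂.tendsto x)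

theorem hasTransform_sum {ι : Type*} (s : Finset ι) {φ g : ι → F → C}
    (h : ∀ i ∈ s, HasTransform p ψ (φ i) (g i)) :
    HasTransform p ψ (∑ i ∈ s, φ i) (∑ i ∈ s, g i) := by
  classical
  induction s using Finset.induction_on with
  | empty => simpa using hasTransform_zero
  | insert a s ha ih =>
    rw [Finset.sum_insert ha, Finset.sum_insert ha]
    exact (h a (Finset.mem_insert_self _ _)).add
      (ih fun i hi => h i (Finset.mem_insert_of_mem hi))

theorem finsum_char_of_mem (hψ : IsSelfDual p ψ) {n k : ℕ} {b : F} (hb : b ∈ lattice p F k) :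
    ∑ᶠ c : F ⧸ lattice p F n,
      (ball p F k : Set F).indicator (fun y => ψ (b * y)) (Quotient.out c)
      = ((lattice p F n).relIndex (ball p F k) : C) := by
  have hfin := finite_out_mem_ball p (F := F) n k
  rw [← ncard_out_mem_ball, Set.ncard_eq_toFinset_card _ hfin,
    finsum_eq_sum_of_support_subset (s := hfin.toFinset), Finset.sum_congr rfl
      (g := fun _ => (1 : C))]
  · simp
  · intro c hc
    have hc' : Quotient.out c ∈ (ball p F k : Set F) := hfin.mem_toFinset.1 hc
    rw [Set.indicator_of_mem hc', hψ.mem_lattice_iff.1 hb _ hc']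
  · intro c hc
    rw [Set.Finite.coe_toFinset]
    by_contra hne
    exact hc (Set.indicator_of_notMem (s := (ball p F k : Set F)) hne _)

/-- A character cut off to a ball is transformed to a multiple of the indicator function of a coset
of a lattice, the factor being the volume of the ball. -/
theorem hasTransform_char [CharZero C] (hψ : IsSelfDual p ψ) (k : ℕ) (a : F) (c : C) :
    HasTransform p ψ ((ball p F k : Set F).indicator fun y => c * ψ (a * y))
      fun x => (lattice p F k : Set F).indicator
        (fun _ => c * ((integers p F).relIndex (ball p F k) : C)) (x + a) := by
  have hopen : IsOpen (ball p F k : Set F) :=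
    AddSubgroup.isOpen_mono ((lattice_le_integers p 0).trans (integers_le_ball p k))
      (isOpen_lattice p 0)
  refine ⟨?_, ?_, fun x => ?_⟩
  · refine IsSchwartz.of_forall_norm_lt ?_ ((p : ℝ) ^ k) fun x hx =>
      Set.indicator_of_notMem (s := (ball p F k : Set F)) (fun h => hx.not_ge h) _
    have hl : IsLocallyConstant fun y => c * ψ (a * y) := (IsLocallyConstant.const c).mul
      (hψ.isLocallyConstant a)
    simpa using isLocallyConstant_indicator_coset (ball p F k) hopen 0 hl
  · refine IsSchwartz.of_forall_norm_lt
      (isLocallyConstant_indicator_coset _ (isOpen_lattice p k) a (IsLocallyConstant.const _))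
      (1 + ‖a‖) fun x hx => Set.indicator_of_notMem (fun h => hx.not_ge ?_) _
    have h' : ‖x + a‖ ≤ 1 := lattice_le_integers p k h
    calc ‖x‖ = ‖x + a - a‖ := by rw [add_sub_cancel_right]
      _ ≤ ‖x + a‖ + ‖a‖ := norm_sub_le _ _
      _ ≤ 1 + ‖a‖ := by gcongr
  · -- The Riemann sums are constant once the character is trivial on the cosets.
    obtain ⟨n₀, hn₀⟩ := exists_le_cast_prime_pow p ‖x + a‖
    refine tendsto_const_nhds.congr' ?_
    filter_upwards [eventually_ge_atTop n₀] with n hn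
    have hxa : x + a ∈ ball p F n :=
      hn₀.trans (pow_le_pow_right₀ (Nat.one_le_cast.2 hp.out.one_le) hn)
    have htriv : ∀ y ∈ lattice p F n, ψ ((x + a) * y) = 1 := fun y hy => by
      rw [mul_comm]
      exact hψ.mem_lattice_iff.1 hy _ hxa
    have hfun : ∀ y, (ball p F k : Set F).indicator (fun y => c * ψ (a * y)) y * ψ (x * y)
        = c * (ball p F k : Set F).indicator (fun y => ψ ((x + a) * y)) y := fun y => by
      by_cases hy : y ∈ (ball p F k : Set F)
      · rw [Set.indicator_of_mem hy, Set.indicator_of_mem hy, add_mul, AddChar.map_add_eq_mul]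
        ring
      · rw [Set.indicator_of_notMem hy, Set.indicator_of_notMem hy, zero_mul, mul_zero]
    simp only [riemannSum, hfun]
    rw [← mul_finsum]
    by_cases hx : x + a ∈ lattice p F k
    · rw [Set.indicator_of_mem (SetLike.mem_coe.2 hx), finsum_char_of_mem hψ hx,
        ← AddSubgroup.relIndex_mul_relIndex _ _ _ (lattice_le_integers p n)
          (integers_le_ball p k), Nat.cast_mul]
      have hne : ((lattice p F n).relIndex (integers p F) : C) ≠ 0 := by
        rw [Nat.cast_ne_zero]
        intro h
        refine relIndex_lattice_ball_ne_zero p (F := F) n k ?_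
        rw [← AddSubgroup.relIndex_mul_relIndex _ _ _ (lattice_le_integers p n)
          (integers_le_ball p k), h, zero_mul]
      field_simp
    · rw [Set.indicator_of_notMem (fun h => hx h), finsum_char_of_notMem hψ htriv hx, mul_zero,
        zero_div]

end Transform

/-! ### Combinations of characters -/

section CharCombination

variable {p : ℕ} [hp : Fact p.Prime] {F : Type*} [NormedField F] [NormedAlgebra ℚ_[p] F]
  {C : Type*} [NormedField C] {ψ : AddChar F C}

/-- The functions `∑ c_a ψ(a y)` (finite sums) with coefficients bounded by `M`. -/
def charCombination (ψ : AddChar F C) (M : ℝ) : AddSubmonoid (F → C) :=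
  AddSubmonoid.closure {f | ∃ c a, ‖c‖ ≤ M ∧ f = fun y => c * ψ (a * y)}

theorem mul_char_mem_charCombination {M : ℝ} {c : C} (hc : ‖c‖ ≤ M) (a : F) :
    (fun y => c * ψ (a * y)) ∈ charCombination ψ M :=
  AddSubmonoid.subset_closure ⟨c, a, hc, rfl⟩

theorem charCombination_mono {M M' : ℝ} (h : M ≤ M') :
    charCombination ψ M ≤ charCombination ψ M' :=
  AddSubmonoid.closure_mono fun _ ⟨c, a, hc, hf⟩ => ⟨c, a, hc.trans h, hf⟩

theorem mul_mem_charCombination {M M' : ℝ} (hM : 0 ≤ M) {f g : F → C}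
    (hf : f ∈ charCombination ψ M) (hg : g ∈ charCombination ψ M') :
    f * g ∈ charCombination ψ (M * M') := by
  induction hf using AddSubmonoid.closure_induction with
  | mem f h =>
    obtain ⟨c, a, hc, rfl⟩ := h
    induction hg using AddSubmonoid.closure_induction with
    | mem f h =>
      obtain ⟨c', a', hc', rfl⟩ := h
      have : ((fun y => c * ψ (a * y)) * fun y => c' * ψ (a' * y))
          = fun y => (c * c') * ψ ((a + a') * y) := by
        funext y
        rw [Pi.mul_apply, add_mul, AddChar.map_add_eq_mul]
        ring
      rw [this]
      exact mul_char_mem_charCombination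
        ((norm_mul _ _).trans_le (mul_le_mul hc hc' (norm_nonneg _) hM)) _
    | zero => rw [mul_zero]; exact zero_mem _
    | add f g _ _ hf hg => rw [mul_add]; exact add_mem hf hg
  | zero => rw [zero_mul]; exact zero_mem _
  | add f g _ _ hf hg => rw [add_mul]; exact add_mem hf hg

theorem prod_mem_charCombination {ι : Type*} (s : Finset ι) {M : ℝ} (hM : 0 ≤ M) {f : ι → F → C}
    (hf : ∀ i ∈ s, f i ∈ charCombination ψ M) :
    ∏ i ∈ s, f i ∈ charCombination ψ (M ^ s.card) := by
  classical
  induction s using Finset.induction_on with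
  | empty =>
    simpa [Pi.one_def] using
      mul_char_mem_charCombination (ψ := ψ) (M := 1) (c := (1 : C)) norm_one.le 0
  | insert a s ha ih =>
    rw [Finset.prod_insert ha, Finset.card_insert_of_notMem ha, pow_succ']
    exact mul_mem_charCombination hM (hf a (Finset.mem_insert_self _ _))
      (ih fun i hi => hf i (Finset.mem_insert_of_mem hi))

theorem eval_char_mem_charCombination {M : ℝ} {P : Polynomial C} (hP : ∀ i, ‖P.coeff i‖ ≤ M)
    (a : F) : (fun y => P.eval (ψ (a * y))) ∈ charCombination ψ M := by
  have : (fun y => P.eval (ψ (a * y)))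
      = ∑ i ∈ P.support, fun y => P.coeff i * ψ ((i * a) * y) := by
    funext y
    rw [Polynomial.eval_eq_sum, Polynomial.sum, Finset.sum_apply]
    refine Finset.sum_congr rfl fun i _ => ?_
    rw [← AddChar.map_nsmul_eq_pow, nsmul_eq_mul, mul_assoc]
  rw [this]
  exact sum_mem fun i _ => mul_char_mem_charCombination (hP i) _

theorem mul_comp_sub_mem_charCombination (hψ : IsSelfDual p ψ) {M δ : ℝ} (hM : 0 ≤ M) {f : F → C}
    (hf : f ∈ charCombination ψ M) {c : C} (hc : ‖c‖ ≤ δ) (z : F) :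
    (fun y => c * f (y - z)) ∈ charCombination ψ (M * δ) := by
  induction hf using AddSubmonoid.closure_induction with
  | mem f h =>
    obtain ⟨c', a, hc', rfl⟩ := h
    have : (fun y => c * (c' * ψ (a * (y - z))))
        = fun y => (c' * c * ψ (-(a * z))) * ψ (a * y) := by
      funext y
      rw [mul_sub, sub_eq_add_neg, AddChar.map_add_eq_mul]
      ring
    simp only [this]
    refine mul_char_mem_charCombination ?_ _
    rw [norm_mul, hψ.norm_eq_one, mul_one, norm_mul]
    exact mul_le_mul hc' hc (norm_nonneg _) hM
  | zero =>
    simp only [Pi.zero_apply, mul_zero]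
    exact zero_mem _
  | add f g _ _ hf hg =>
    simp only [Pi.add_apply, mul_add]
    exact add_mem hf hg

theorem isLocallyConstant_of_mem_charCombination (hψ : IsSelfDual p ψ) {M : ℝ} {f : F → C}
    (hf : f ∈ charCombination ψ M) : IsLocallyConstant f := by
  induction hf using AddSubmonoid.closure_induction with
  | mem f h =>
    obtain ⟨c, a, _, rfl⟩ := h
    exact (IsLocallyConstant.const c).mul (hψ.isLocallyConstant a)
  | zero => exact IsLocallyConstant.const 0
  | add f g _ _ hf hg => exact hf.add hg

/-- Cutting off to a large ball makes the Fourier transform of a combination of characters small,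
because the volume of the ball is divisible by a high power of `p`. -/
theorem exists_hasTransform_indicator [NormedAlgebra ℚ_[p] C] [ProperSpace F] (hψ : IsSelfDual p ψ)
    {M : ℝ} (hM : 0 ≤ M) (k : ℕ) {f : F → C} (hf : f ∈ charCombination ψ M) :
    ∃ g, HasTransform p ψ ((ball p F k : Set F).indicator f) g ∧
      ∀ x, ‖g x‖ ≤ M * ((p : ℝ) ^ k)⁻¹ := by
  have : IsUltrametricDist C := IsUltrametricDist.of_normedAlgebra ℚ_[p]
  have : CharZero C := charZero_of_injective_algebraMap (algebraMap ℚ_[p] C).injective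
  have hbound : 0 ≤ M * ((p : ℝ) ^ k)⁻¹ :=
    mul_nonneg hM (inv_nonneg.2 (cast_prime_pow_pos p k).le)
  induction hf using AddSubmonoid.closure_induction with
  | mem f h =>
    obtain ⟨c, a, hc, rfl⟩ := h
    refine ⟨_, hasTransform_char hψ k a c, fun x => ?_⟩
    refine (norm_indicator_le_norm_self _ _).trans ?_
    rw [norm_mul]
    exact mul_le_mul hc (norm_relIndex_integers_ball_le k) (norm_nonneg _) hM
  | zero =>
    refine ⟨0, ?_, fun x => by simpa using hbound⟩
    rw [Set.indicator_zero']
    exact hasTransform_zero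
  | add f g _ _ hf hg =>
    obtain ⟨f', hf', hfb⟩ := hf
    obtain ⟨g', hg', hgb⟩ := hg
    refine ⟨f' + g', ?_, fun x => (IsUltrametricDist.norm_add_le_max _ _).trans
      (max_le (hfb x) (hgb x))⟩
    rw [Set.indicator_add']
    exact hf'.add hg'

end CharCombination

/-! ### Locally constant functions on a ball as sums over cosets -/

section Cosets

variable {p : ℕ} [hp : Fact p.Prime] {F : Type*} [NormedField F] [NormedAlgebra ℚ_[p] F]
  [ProperSpace F] {C : Type*} [NormedField C]

variable (p) in
theorem exists_lattice_invariant {E : Type*} {f : F → E} (hf : IsLocallyConstant f) (k : ℕ) :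
    ∃ n, ∀ y ∈ ball p F k, ∀ w ∈ lattice p F n, f (y + w) = f y := by
  rw [IsLocallyConstant.iff_eventually_eq] at hf
  have h : ∀ x : F, ∃ n, ∀ w ∈ lattice p F n, f (x + w) = f x := fun x => by
    have hc : Tendsto (fun w : F => x + w) (𝓝 0) (𝓝 x) := by
      simpa using (continuous_const.add continuous_id).tendsto (x := (0 : F))
        (f := fun w : F => x + w)
    exact exists_lattice_subset_of_mem_nhds p (hc.eventually (hf x))
  choose n hn using h
  have hnhds : ∀ x ∈ (ball p F k : Set F), {y | y - x ∈ lattice p F (n x)} ∈ 𝓝 x := fun x _ => by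
    have hc : Tendsto (fun y : F => y - x) (𝓝 x) (𝓝 0) := by
      simpa using (continuous_id.sub continuous_const).tendsto (x := x) (f := fun y : F => y - x)
    exact hc ((isOpen_lattice p (n x)).mem_nhds (zero_mem _))
  obtain ⟨T, -, hT⟩ := (isCompact_ball p k).elim_nhds_subcover _ hnhds
  refine ⟨T.sup n, fun y hy w hw => ?_⟩
  obtain ⟨x, hx, hyx⟩ := Set.mem_iUnion₂.1 (hT hy)
  have hyx' : y - x ∈ lattice p F (n x) := hyx
  have hw' : w ∈ lattice p F (n x) := lattice_antitone p (Finset.le_sup hx) hw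
  have h1 := hn x _ hyx'
  have h2 := hn x _ (add_mem hyx' hw')
  rw [show x + (y - x + w) = y + w by ring] at h2
  rw [add_sub_cancel] at h1
  rw [h1, h2]

theorem exists_sum_indicator_eq {k n : ℕ} (H : AddSubgroup F) (hn : lattice p F n ≤ H)
    (hH : H ≤ ball p F k) {f : F → C} (hf : ∀ y ∈ ball p F k, ∀ w ∈ H, f (y + w) = f y) :
    ∃ T : Finset F, (∀ t ∈ T, t ∈ ball p F k) ∧
      ∀ y ∈ ball p F k, f y = ∑ t ∈ T, (H : Set F).indicator (fun _ => f t) (y - t) := by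
  classical
  let m : F → F ⧸ H := fun y => y
  have hfin : (m '' (ball p F k : Set F)).Finite := by
    refine ((finite_out_mem_ball p (F := F) n k).image fun c => m (Quotient.out c)).subset ?_
    rintro _ ⟨y, hy, rfl⟩
    obtain ⟨w, hw⟩ := QuotientAddGroup.mk_out_eq_add (lattice p F n) y
    refine ⟨(y : F ⧸ lattice p F n), ?_, ?_⟩
    · change Quotient.out (y : F ⧸ lattice p F n) ∈ ball p F k
      rw [hw]
      exact add_mem hy (hH (hn w.2))
    · refine QuotientAddGroup.eq.2 ?_
      rw [hw]
      simpa using neg_mem (hn w.2)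
  let o : F ⧸ H → F := Quotient.out
  have hm : ∀ y (c : F ⧸ H), y - o c ∈ H ↔ m y = c := fun y c => by
    conv_rhs => rw [← QuotientAddGroup.out_eq' c]
    rw [eq_comm, QuotientAddGroup.eq, neg_add_eq_sub]
  have hinj : Function.Injective o := Quotient.out_injective
  have hball : ∀ y ∈ ball p F k, o (m y) ∈ ball p F k := fun y hy => by
    obtain ⟨w, hw⟩ := QuotientAddGroup.mk_out_eq_add H y
    change Quotient.out (y : F ⧸ H) ∈ ball p F k
    rw [hw]
    exact add_mem hy (hH w.2)
  refine ⟨hfin.toFinset.image o, fun t ht => ?_, fun y hy => ?_⟩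
  · obtain ⟨c, hc, rfl⟩ := Finset.mem_image.1 ht
    obtain ⟨y, hy, rfl⟩ := hfin.mem_toFinset.1 hc
    exact hball y hy
  · rw [Finset.sum_image fun _ _ _ _ h => hinj h, Finset.sum_eq_single (m y)]
    · have hmem : y - o (m y) ∈ H := (hm _ _).2 rfl
      rw [Set.indicator_of_mem (SetLike.mem_coe.2 hmem)]
      conv_lhs => rw [← add_sub_cancel (o (m y)) y]
      exact hf _ (hball y hy) _ hmem
    · intro c _ hc
      exact Set.indicator_of_notMem (s := (H : Set F)) (fun h => hc ((hm _ _).1 h).symm) _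
    · intro h
      exact absurd (hfin.mem_toFinset.2 ⟨y, hy, rfl⟩) h

/-- Every Schwartz function is a Fourier transform. -/
theorem IsSchwartz.exists_hasTransform [CharZero C] {ψ : AddChar F C} (hψ : IsSelfDual p ψ)
    {s : F → C} (hs : IsSchwartz s) : ∃ θ, HasTransform p ψ θ s := by
  obtain ⟨k₀, hk₀⟩ := hs.exists_eq_zero p
  obtain ⟨n, hn⟩ := exists_lattice_invariant p hs.1 k₀
  set k := max k₀ n with hk
  have hinv : ∀ y ∈ ball p F k, ∀ w ∈ lattice p F k, s (y + w) = s y := fun y _ w hw => by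
    have hw' := lattice_antitone p (le_max_right k₀ n) hw
    by_cases hy : y ∈ ball p F k₀
    · exact hn y hy w hw'
    · rw [hk₀ _ le_rfl _ hy, hk₀ _ le_rfl]
      rwa [(ball p F k₀).add_mem_cancel_right
        ((lattice_le_integers p _).trans (integers_le_ball p k₀) hw)]
  have hle := (lattice_le_integers p (F := F) k).trans (integers_le_ball p k)
  obtain ⟨T, hT, hsum⟩ := exists_sum_indicator_eq (lattice p F k) le_rfl hle hinv
  set N : C := ((integers p F).relIndex (ball p F k) : C) with hN
  have hN0 : N ≠ 0 := Nat.cast_ne_zero.2 (relIndex_integers_ball_ne_zero p k)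
  have key := hasTransform_sum (p := p) (ψ := ψ) T fun t _ =>
    hasTransform_char hψ k (-t) (s t * N⁻¹)
  refine ⟨∑ t ∈ T, (ball p F k : Set F).indicator fun y => s t * N⁻¹ * ψ (-t * y), ?_⟩
  convert key using 1
  funext x
  rw [Finset.sum_apply]
  simp only [← hN, inv_mul_cancel_right₀ hN0, ← sub_eq_add_neg]
  by_cases hx : x ∈ ball p F k
  · exact hsum x hx
  · rw [hk₀ k (le_max_left _ _) x hx]
    refine (Finset.sum_eq_zero fun t ht => Set.indicator_of_notMem
      (s := (lattice p F k : Set F)) (fun h => hx ?_) _).symm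
    simpa using add_mem (hle h) (hT t ht)

end Cosets

/-! ### Approximation by combinations of characters with bounded coefficients -/

section Approximation

variable {p : ℕ} [hp : Fact p.Prime] {F : Type*} [NormedField F] [NormedAlgebra ℚ_[p] F]
  {C : Type*} [NormedField C] {ψ : AddChar F C}

/-- A finite set of characters separates `0` from all elements outside `𝒪_F`. By compactness it
suffices to treat `p ^ (-1) 𝒪_F \ 𝒪_F`, and every element outside `𝒪_F` is moved there by
a power of `p`. -/
theorem exists_finset_forall_char_eq_one [ProperSpace F] (hψ : IsSelfDual p ψ) :
    ∃ A : Finset F, ∀ z, (∀ a ∈ A, ψ (a * z) = 1) → ‖z‖ ≤ 1 := by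
  have hcompact : IsCompact ((ball p F 1 : Set F) \ lattice p F 0) :=
    (isCompact_ball p 1).diff (isOpen_lattice p 0)
  obtain ⟨A, hA⟩ := hcompact.elim_finite_subcover (fun a => {z | ψ (a * z) ≠ 1})
    (fun a => hψ.isLocallyConstant a {1}ᶜ) (fun z hz => by
      have hz' : z ∉ integers p F := fun h =>
        hz.2 ((mem_lattice p).2 (by rw [pow_zero, inv_one]; exact h))
      have : z ∉ {x : F | ∀ y ∈ integers p F, ψ (x * y) = 1} := by rwa [hψ]
      simp only [Set.mem_ofPred_eq, not_forall] at this
      obtain ⟨a, _, ha⟩ := this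
      exact Set.mem_iUnion.2 ⟨a, by rwa [mul_comm] at ha⟩)
  refine ⟨A, fun z hz => ?_⟩
  by_contra hlt
  have hex := exists_le_cast_prime_pow p ‖z‖
  classical
  obtain ⟨m, hm⟩ : ∃ m, Nat.find hex = m + 1 := by
    refine Nat.exists_eq_succ_of_ne_zero fun h0 => hlt ?_
    simpa [h0] using Nat.find_spec hex
  have h1 : ‖z‖ ≤ (p : ℝ) ^ (m + 1) := hm ▸ Nat.find_spec hex
  have h2 : (p : ℝ) ^ m < ‖z‖ := not_le.1 (Nat.find_min hex (by omega))
  have hnorm : ‖(p : F) ^ m * z‖ = ((p : ℝ) ^ m)⁻¹ * ‖z‖ := by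
    rw [norm_mul, norm_pow, norm_natCast_prime, inv_pow]
  have hmem : (p : F) ^ m * z ∈ (ball p F 1 : Set F) \ lattice p F 0 := by
    constructor
    · change ‖(p : F) ^ m * z‖ ≤ (p : ℝ) ^ 1
      rw [hnorm, inv_mul_le_iff₀ (cast_prime_pow_pos p m), ← pow_add]
      exact h1
    · intro h
      have h' := (mem_lattice p).1 h
      rw [hnorm, pow_zero, inv_one, inv_mul_le_iff₀ (cast_prime_pow_pos p m), mul_one] at h'
      exact h2.not_ge h'
  obtain ⟨a, ha, ha'⟩ := Set.mem_iUnion₂.1 (hA hmem)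
  refine ha' ?_
  rw [show a * ((p : F) ^ m * z) = (p ^ m : ℕ) • (a * z) by rw [nsmul_eq_mul]; push_cast; ring,
    AddChar.map_nsmul_eq_pow, hz a ha, one_pow]

theorem norm_prod_sub_prod_le [IsUltrametricDist C] {ι : Type*} (s : Finset ι) {x y : ι → C} {μ : ℝ}
    (hμ : 0 ≤ μ) (hx : ∀ i, ‖x i‖ ≤ 1) (hy : ∀ i, ‖y i‖ ≤ 1) (h : ∀ i, ‖x i - y i‖ ≤ μ) :
    ‖∏ i ∈ s, x i - ∏ i ∈ s, y i‖ ≤ μ := by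
  classical
  induction s using Finset.induction_on with
  | empty => simpa using hμ
  | insert a s ha ih =>
    rw [Finset.prod_insert ha, Finset.prod_insert ha,
      show x a * ∏ i ∈ s, x i - y a * ∏ i ∈ s, y i
        = x a * (∏ i ∈ s, x i - ∏ i ∈ s, y i) + (x a - y a) * ∏ i ∈ s, y i by ring]
    refine (IsUltrametricDist.norm_add_le_max _ _).trans (max_le ?_ ?_)
    · rw [norm_mul]
      exact (mul_le_of_le_one_left (norm_nonneg _) (hx a)).trans ih
    · rw [norm_mul, norm_prod]
      exact (mul_le_of_le_one_right (norm_nonneg _)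
        (Finset.prod_le_one (fun _ _ => norm_nonneg _) fun i _ => hy i)).trans (h a)

variable [NormedAlgebra ℚ_[p] C] [IsAlgClosed C]

/-- The indicator function of the common kernel of the characters `ψ(α a ·)`, `a ∈ A`, is
approximated on a ball, with a precision and a bound for the coefficients that depend only on the
number of characters. -/
theorem exists_charCombination_approx_indicator (hψ : IsSelfDual p ψ) (k : ℕ) (A : Finset F)
    (α : F → F) :
    ∃ b ∈ charCombination ψ ((p : ℝ) ^ A.card), ∀ y ∈ ball p F k,
      ‖{z | ∀ a ∈ A, ψ (α a * z) = 1}.indicator (fun _ => (1 : C)) y - b y‖ ≤ √(p : ℝ)⁻¹ := by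
  classical
  have : IsUltrametricDist C := IsUltrametricDist.of_normedAlgebra ℚ_[p]
  have : CharZero C := charZero_of_injective_algebraMap (algebraMap ℚ_[p] C).injective
  have hp0 := natCast_prime_ne_zero p F
  have hroots : ∀ n, ∃ q : C, IsPrimitiveRoot q (p ^ n) := fun n => by
    have : NeZero (p ^ n) := ⟨pow_ne_zero _ hp.out.ne_zero⟩
    exact HasEnoughRootsOfUnity.exists_primitiveRoot C (p ^ n)
  obtain ⟨r, hr⟩ := exists_le_cast_prime_pow p (∑ a ∈ A, ‖α a‖ * (p : ℝ) ^ k)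
  obtain ⟨l, P, hP, happrox⟩ := exists_polynomial_approx p (norm_natCast_prime p C) hroots r
  have hμ1 : √(p : ℝ)⁻¹ ≤ 1 :=
    Real.sqrt_le_one.2 (inv_le_one_of_one_le₀ (Nat.one_le_cast.2 hp.out.one_le))
  refine ⟨∏ a ∈ A, fun y => P.eval (ψ ((α a * ((p : F) ^ l)⁻¹) * y)),
    prod_mem_charCombination _ (Nat.cast_nonneg p)
      fun a _ => eval_char_mem_charCombination hP _, fun y hy => ?_⟩
  have hind : {z | ∀ a ∈ A, ψ (α a * z) = 1}.indicator (fun _ => (1 : C)) y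
      = ∏ a ∈ A, if ψ (α a * y) = 1 then 1 else 0 := by
    rw [Finset.prod_ite_zero, Finset.prod_const_one, Set.indicator_apply]
    rfl
  have hle : ∀ a : A, ‖(if ψ (α a * y) = 1 then (1 : C) else 0)‖ ≤ 1 := fun a => by
    split_ifs <;> simp
  have hdiff : ∀ a : A, ‖(if ψ (α a * y) = 1 then (1 : C) else 0)
      - P.eval (ψ ((α a * ((p : F) ^ l)⁻¹) * y))‖ ≤ √(p : ℝ)⁻¹ := fun a => by
    have hpow : ψ ((α a * ((p : F) ^ l)⁻¹) * y) ^ p ^ l = ψ (α a * y) := by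
      rw [← AddChar.map_nsmul_eq_pow, nsmul_eq_mul, Nat.cast_pow]
      congr 1
      field_simp
    have hroot : ψ ((α a * ((p : F) ^ l)⁻¹) * y) ^ p ^ (l + r) = 1 := by
      rw [pow_add, pow_mul, hpow]
      refine hψ.pow_eq_one (le_trans ?_ hr)
      rw [norm_mul]
      refine (mul_le_mul_of_nonneg_left hy (norm_nonneg _)).trans ?_
      exact Finset.single_le_sum (f := fun a => ‖α a‖ * (p : ℝ) ^ k)
        (fun a _ => mul_nonneg (norm_nonneg _) (cast_prime_pow_pos p k).le) a.2
    have := happrox _ hroot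
    rw [hpow, norm_sub_rev] at this
    convert this
  rw [hind, Finset.prod_apply, ← Finset.prod_coe_sort A, ← Finset.prod_coe_sort A]
  refine norm_prod_sub_prod_le _ (Real.sqrt_nonneg _) hle (fun a => ?_) hdiff
  rw [← sub_sub_cancel (if ψ (α a * y) = 1 then (1 : C) else 0)
    (P.eval (ψ ((α a * ((p : F) ^ l)⁻¹) * y))), sub_eq_add_neg]
  refine (IsUltrametricDist.norm_add_le_max _ _).trans (max_le (hle a) ?_)
  rw [norm_neg]
  exact (hdiff a).trans hμ1

variable [ProperSpace F]

/-- One step of the approximation gains the factor `p ^ (-1 / 2)`, at a cost in the coefficients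
that depends only on `A`. -/
theorem exists_charCombination_approx_step (hψ : IsSelfDual p ψ) {A : Finset F}
    (hA : ∀ z, (∀ a ∈ A, ψ (a * z) = 1) → ‖z‖ ≤ 1) (k : ℕ) {f : F → C} (hf : IsLocallyConstant f)
    {δ : ℝ} (hδ : 0 ≤ δ) (hfδ : ∀ y ∈ ball p F k, ‖f y‖ ≤ δ) :
    ∃ b ∈ charCombination ψ ((p : ℝ) ^ A.card * δ), ∀ y ∈ ball p F k,
      ‖f y - b y‖ ≤ δ * √(p : ℝ)⁻¹ := by
  have : IsUltrametricDist C := IsUltrametricDist.of_normedAlgebra ℚ_[p]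
  obtain ⟨M, hM⟩ := exists_lattice_invariant p hf k
  let α : F → F := fun a => a * ((p : F) ^ M)⁻¹
  -- The common kernel of the characters `ψ(p ^ (-M) a ·)` lies in `p ^ M 𝒪_F`.
  let H : AddSubgroup F :=
    { carrier := {z | ∀ a ∈ A, ψ (α a * z) = 1}
      add_mem' := fun {x y} hx hy a ha => by
        rw [mul_add, AddChar.map_add_eq_mul, hx a ha, hy a ha, one_mul]
      zero_mem' := fun a _ => by rw [mul_zero, AddChar.map_zero_eq_one]
      neg_mem' := fun {x} hx a ha => by
        rw [mul_neg, AddChar.map_neg_eq_inv, hx a ha, inv_one] }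
  have hHle : H ≤ lattice p F M := fun z hz => by
    have h1 : ‖((p : F) ^ M)⁻¹ * z‖ ≤ 1 := hA _ fun a ha => by
      rw [← mul_assoc]
      exact hz a ha
    rw [norm_mul, norm_inv, norm_pow, norm_natCast_prime, inv_pow, inv_inv] at h1
    rwa [mem_lattice, ← one_div, le_div_iff₀' (cast_prime_pow_pos p M)]
  obtain ⟨n, hn⟩ := exists_le_cast_prime_pow p (∑ a ∈ A, ‖α a‖)
  have hnH : lattice p F n ≤ H := fun z hz a ha => by
    rw [mul_comm]
    refine hψ.mem_lattice_iff.1 hz _ ?_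
    exact (Finset.single_le_sum (f := fun a => ‖α a‖) (fun a _ => norm_nonneg _) ha).trans hn
  have hHball : H ≤ ball p F k :=
    hHle.trans ((lattice_le_integers p _).trans (integers_le_ball p k))
  obtain ⟨T, hT, hsum⟩ := exists_sum_indicator_eq H hnH hHball
    fun y hy w hw => hM y hy w (hHle hw)
  obtain ⟨b, hb, hbapprox⟩ := exists_charCombination_approx_indicator hψ k A α
  refine ⟨∑ t ∈ T, fun y => f t * b (y - t), sum_mem fun t ht =>
    mul_comp_sub_mem_charCombination hψ (cast_prime_pow_pos p _).le hb (hfδ t (hT t ht)) t,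
    fun y hy => ?_⟩
  rw [hsum y hy, Finset.sum_apply, ← Finset.sum_sub_distrib]
  refine IsUltrametricDist.norm_sum_le_of_forall_le_of_nonneg
    (mul_nonneg hδ (Real.sqrt_nonneg _)) fun t ht => ?_
  have hind : (H : Set F).indicator (fun _ => f t) (y - t)
      = f t * (H : Set F).indicator (fun _ => (1 : C)) (y - t) := by
    by_cases h : y - t ∈ (H : Set F)
    · rw [Set.indicator_of_mem h, Set.indicator_of_mem h, mul_one]
    · rw [Set.indicator_of_notMem h, Set.indicator_of_notMem h, mul_zero]
  rw [hind, ← mul_sub, norm_mul]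
  exact mul_le_mul (hfδ t (hT t ht)) (hbapprox _ (sub_mem hy (hT t ht))) (norm_nonneg _) hδ

theorem exists_charCombination_approx (hψ : IsSelfDual p ψ) {A : Finset F}
    (hA : ∀ z, (∀ a ∈ A, ψ (a * z) = 1) → ‖z‖ ≤ 1) (k : ℕ) {f : F → C} (hf : IsLocallyConstant f)
    {δ : ℝ} (hδ : 0 ≤ δ) (hfδ : ∀ y ∈ ball p F k, ‖f y‖ ≤ δ) (s : ℕ) :
    ∃ b ∈ charCombination ψ ((p : ℝ) ^ A.card * δ), ∀ y ∈ ball p F k,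
      ‖f y - b y‖ ≤ δ * √(p : ℝ)⁻¹ ^ s := by
  have hμ1 : √(p : ℝ)⁻¹ ≤ 1 :=
    Real.sqrt_le_one.2 (inv_le_one_of_one_le₀ (Nat.one_le_cast.2 hp.out.one_le))
  induction s with
  | zero => exact ⟨0, zero_mem _, fun y hy => by simpa using hfδ y hy⟩
  | succ s ih =>
    obtain ⟨b, hb, hbf⟩ := ih
    have hδs : 0 ≤ δ * √(p : ℝ)⁻¹ ^ s := mul_nonneg hδ (pow_nonneg (Real.sqrt_nonneg _) _)
    obtain ⟨b', hb', hbf'⟩ := exists_charCombination_approx_step hψ hA k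
      (hf.sub (isLocallyConstant_of_mem_charCombination hψ hb)) hδs hbf
    refine ⟨b + b', add_mem hb (charCombination_mono ?_ hb'), fun y hy => ?_⟩
    · refine mul_le_mul_of_nonneg_left ?_ (cast_prime_pow_pos p _).le
      exact mul_le_of_le_one_right hδ (pow_le_one₀ (Real.sqrt_nonneg _) hμ1)
    · rw [Pi.add_apply, ← sub_sub, pow_succ, ← mul_assoc]
      exact hbf' y hy

/-- Every Schwartz function is uniformly close to one whose Fourier transform is uniformly small. -/
theorem IsSchwartz.exists_approx_small_transform (hψ : IsSelfDual p ψ) {φ : F → C}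
    (hφ : IsSchwartz φ) {ε : ℝ} (hε : 0 < ε) :
    ∃ φ' g, HasTransform p ψ φ' g ∧ (∀ x, ‖φ x - φ' x‖ ≤ ε) ∧ ∀ x, ‖g x‖ ≤ ε := by
  obtain ⟨A, hA⟩ := exists_finset_forall_char_eq_one hψ
  obtain ⟨δ, hδ, hφδ⟩ := hφ.exists_norm_le
  obtain ⟨k₀, hk₀⟩ := hφ.exists_eq_zero p
  set D : ℝ := (p : ℝ) ^ A.card * δ with hD
  have hD0 : 0 ≤ D := mul_nonneg (cast_prime_pow_pos p _).le hδ
  -- The bound `D` does not depend on the radius `p ^ k` of the ball.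
  obtain ⟨k₁, hk₁⟩ := exists_le_cast_prime_pow p (D / ε)
  set k := max k₀ k₁
  have hDk : D * ((p : ℝ) ^ k)⁻¹ ≤ ε := by
    rw [mul_inv_le_iff₀ (cast_prime_pow_pos p k)]
    rw [div_le_iff₀' hε] at hk₁
    exact hk₁.trans (mul_le_mul_of_nonneg_left
      (pow_le_pow_right₀ (Nat.one_le_cast.2 hp.out.one_le) (le_max_right _ _)) hε.le)
  have hμ1 : √(p : ℝ)⁻¹ < 1 := by
    rw [Real.sqrt_lt' one_pos, one_pow]
    exact inv_lt_one_of_one_lt₀ (Nat.one_lt_cast.2 hp.out.one_lt)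
  obtain ⟨s, hs⟩ : ∃ s, δ * √(p : ℝ)⁻¹ ^ s < ε := by
    have h := (tendsto_pow_atTop_nhds_zero_of_lt_one (Real.sqrt_nonneg _) hμ1).const_mul δ
    rw [mul_zero] at h
    exact (h.eventually (gt_mem_nhds hε)).exists
  obtain ⟨b, hb, hbφ⟩ := exists_charCombination_approx hψ hA k hφ.1 hδ (fun y _ => hφδ y) s
  obtain ⟨g, hg, hgD⟩ := exists_hasTransform_indicator hψ hD0 k hb
  refine ⟨_, g, hg, fun x => ?_, fun x => (hgD x).trans hDk⟩
  by_cases hx : x ∈ ball p F k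
  · rw [Set.indicator_of_mem (SetLike.mem_coe.2 hx)]
    exact (hbφ x hx).trans hs.le
  · rw [Set.indicator_of_notMem (s := (ball p F k : Set F)) hx, hk₀ k (le_max_left _ _) x hx,
      sub_zero, norm_zero]
    exact hε.le

end Approximation

/-! ### Density of the graph -/

section Density

variable {p : ℕ} [hp : Fact p.Prime] {F : Type*} [NormedField F] [NormedAlgebra ℚ_[p] F]
  {C : Type*} [NormedField C]

/-- A Schwartz function, seen as an element of `C₀(F)` with values in the completion of `C`. -/
noncomputable def IsSchwartz.toZeroAtInfty {φ : F → C} (hφ : IsSchwartz φ) :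
    C₀(F, UniformSpace.Completion C) where
  toFun x := (φ x : UniformSpace.Completion C)
  continuous_toFun := (UniformSpace.Completion.continuous_coe C).comp hφ.1.continuous
  zero_at_infty' := by
    have h : HasCompactSupport fun x => (φ x : UniformSpace.Completion C) :=
      hφ.2.comp_left (g := fun c : C => (c : UniformSpace.Completion C))
        UniformSpace.Completion.coe_zero
    exact h.is_zero_at_infty

theorem exists_isSchwartz_approx (p : ℕ) [Fact p.Prime] {F : Type*} [NormedField F]
    [NormedAlgebra ℚ_[p] F] [ProperSpace F] {C : Type*} [NormedField C]
    (f : C₀(F, UniformSpace.Completion C)) {ε : ℝ}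
    (hε : 0 < ε) :
    ∃ s : F → C, IsSchwartz s ∧ ∀ x, ‖f x - (s x : UniformSpace.Completion C)‖ ≤ ε := by
  classical
  have hε2 : 0 < ε / 2 := half_pos hε
  obtain ⟨δ, hδ, hfδ⟩ := Metric.uniformContinuous_iff.1
    (ZeroAtInftyContinuousMap.uniformContinuous f) (ε / 2) hε2
  obtain ⟨n, hn⟩ := exists_lattice_subset_of_mem_nhds p (Metric.ball_mem_nhds (0 : F) hδ)
  obtain ⟨R, hR⟩ : ∃ R : ℝ, ∀ x, R < ‖x‖ → ‖f x‖ < ε / 2 := by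
    have h := (zero_at_infty f).eventually (Metric.ball_mem_nhds _ hε2)
    rw [← Metric.cobounded_eq_cocompact, ← comap_norm_atTop,
      (atTop_basis_Ioi.comap _).eventually_iff] at h
    obtain ⟨R, -, hR⟩ := h
    exact ⟨R, fun x hx => mem_ball_zero_iff.1 (hR hx)⟩
  have hdense : ∀ z : UniformSpace.Completion C, ∃ d : C, ‖z - d‖ < ε / 2 := fun z => by
    obtain ⟨d, hd⟩ := UniformSpace.Completion.denseRange_coe.exists_dist_lt z hε2
    exact ⟨d, by rwa [← dist_eq_norm]⟩
  choose d hd using hdense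
  let o : F → F := fun x => Quotient.out (x : F ⧸ lattice p F n)
  have ho : ∀ x, o x - x ∈ lattice p F n := fun x => by
    obtain ⟨w, hw⟩ := QuotientAddGroup.mk_out_eq_add (lattice p F n) x
    change Quotient.out (x : F ⧸ lattice p F n) - x ∈ _
    rw [hw, add_sub_cancel_left]
    exact w.2
  have hfo : ∀ x, ‖f x - f (o x)‖ < ε / 2 := fun x => by
    rw [← dist_eq_norm, dist_comm]
    refine hfδ ?_
    rw [dist_eq_norm]
    exact mem_ball_zero_iff.1 (hn (ho x))
  refine ⟨fun x => if R < ‖o x‖ then 0 else d (f (o x)),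
    IsSchwartz.of_forall_norm_lt ?_ (R + 1) fun x hx => if_pos ?_, fun x => ?_⟩
  · rw [IsLocallyConstant.iff_eventually_eq]
    intro x
    have hc : Tendsto (fun y : F => -x + y) (𝓝 x) (𝓝 0) := by
      simpa using (continuous_const.add continuous_id).tendsto (x := x) (f := fun y : F => -x + y)
    filter_upwards [hc ((isOpen_lattice p n).mem_nhds (zero_mem _))] with y hy
    have hy' : (x : F ⧸ lattice p F n) = y := QuotientAddGroup.eq.2 hy
    have : o y = o x := congrArg Quotient.out hy'.symm
    simp only [this]
  · have h1 : ‖o x - x‖ ≤ 1 := lattice_le_integers p n (ho x)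
    have h2 : ‖x‖ ≤ ‖o x‖ + ‖o x - x‖ := by
      calc ‖x‖ = ‖o x - (o x - x)‖ := by rw [sub_sub_cancel]
        _ ≤ _ := norm_sub_le _ _
    linarith
  · have h := hfo x
    have key : ‖f (o x) - ((if R < ‖o x‖ then 0 else d (f (o x)) : C) :
        UniformSpace.Completion C)‖ < ε / 2 := by
      split_ifs with hlt
      · rw [UniformSpace.Completion.coe_zero, sub_zero]
        exact hR _ hlt
      · exact hd _
    calc _ ≤ ‖f x - f (o x)‖ + ‖f (o x) - ((if R < ‖o x‖ then 0 else d (f (o x)) : C) :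
        UniformSpace.Completion C)‖ := norm_sub_le_norm_sub_add_norm_sub _ _ _
      _ ≤ ε := by linarith

theorem dist_toZeroAtInfty_le {f : C₀(F, UniformSpace.Completion C)} {s φ : F → C}
    (hφ : IsSchwartz φ) {ε : ℝ} (hε : 0 ≤ ε)
    (hs : ∀ x, ‖f x - (s x : UniformSpace.Completion C)‖ ≤ ε) (h : ∀ x, ‖s x - φ x‖ ≤ ε) :
    dist f hφ.toZeroAtInfty ≤ ε + ε := by
  rw [← ZeroAtInftyContinuousMap.dist_toBCF_eq_dist,
    BoundedContinuousFunction.dist_le (add_nonneg hε hε)]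
  intro x
  change dist (f x) (φ x : UniformSpace.Completion C) ≤ _
  rw [dist_eq_norm]
  refine (norm_sub_le_norm_sub_add_norm_sub _ (s x : UniformSpace.Completion C) _).trans
    (add_le_add (hs x) ?_)
  rw [← UniformSpace.Completion.coe_sub, UniformSpace.Completion.norm_coe]
  exact h x

theorem dense_fourierGraph [NormedAlgebra ℚ_[p] C] [IsAlgClosed C] [ProperSpace F]
    {ψ : AddChar F C} (hψ : IsSelfDual p ψ) : Dense (fourierGraph p ψ) := by
  have : CharZero C := charZero_of_injective_algebraMap (algebraMap ℚ_[p] C).injective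
  rw [Metric.dense_iff]
  rintro ⟨f₁, f₂⟩ r hr
  have hε : 0 < r / 3 := by positivity
  obtain ⟨s₁, hs₁, hfs₁⟩ := exists_isSchwartz_approx p f₁ hε
  obtain ⟨s₂, hs₂, hfs₂⟩ := exists_isSchwartz_approx p f₂ hε
  -- Correct a function with transform `s₂` by one with small transform.
  obtain ⟨θ, hθ⟩ := hs₂.exists_hasTransform hψ
  have hsub : IsSchwartz (s₁ - θ) := ⟨hs₁.1.sub hθ.1.1, by
    rw [sub_eq_add_neg]
    exact hs₁.2.add (hθ.1.2.comp_left neg_zero)⟩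
  obtain ⟨φ, g, hφ, hφs, hg⟩ := hsub.exists_approx_small_transform hψ hε
  have hT := hφ.add hθ
  refine ⟨(hT.1.toZeroAtInfty, hT.2.toZeroAtInfty), ?_, φ + θ, hT.1, fun x => rfl, fun x => ?_⟩
  · rw [Metric.mem_ball, dist_comm, Prod.dist_eq]
    refine max_lt ?_ ?_
    · refine (dist_toZeroAtInfty_le hT.1 hε.le hfs₁ fun x => ?_).trans_lt (by linarith)
      rw [Pi.add_apply, add_comm, ← sub_sub]
      exact hφs x
    · refine (dist_toZeroAtInfty_le hT.2 hε.le hfs₂ fun x => ?_).trans_lt (by linarith)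
      rw [Pi.add_apply, sub_add_cancel_right, norm_neg]
      exact hg x
  · rw [hT.fourier_eq]
    rfl

end Density

end PadicFourier

theorem theorem1 (p : ℕ) [Fact p.Prime]
    (F : Type*) [NormedField F] [NormedAlgebra ℚ_[p] F] [FiniteDimensional ℚ_[p] F]
    (C : Type*) [NormedField C] [NormedAlgebra ℚ_[p] C] [IsAlgClosure ℚ_[p] C]
    (ψ : AddChar F C) (hψ : PadicFourier.IsSelfDual p ψ) :
    (∀ φ : F → C, PadicFourier.IsSchwartz φ →
      ∃ φs : ℕ → F → C, (∀ n, PadicFourier.IsSchwartz (φs n)) ∧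
        TendstoUniformly φs φ atTop ∧
        TendstoUniformly (fun n => PadicFourier.fourier p ψ (φs n)) (fun _ => 0) atTop) ∧
    Dense (PadicFourier.fourierGraph p ψ) := by
  have : IsAlgClosed C := IsAlgClosure.isAlgClosed ℚ_[p]
  have : ProperSpace F := FiniteDimensional.proper ℚ_[p] F
  refine ⟨fun φ hφ => ?_, PadicFourier.dense_fourierGraph hψ⟩
  choose φs g hT hφs hg using fun n : ℕ =>
    hφ.exists_approx_small_transform hψ (Nat.one_div_pos_of_nat (α := ℝ) (n := n))
  refine ⟨φs, fun n => (hT n).1, ?_, ?_⟩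
  · rw [Metric.tendstoUniformly_iff]
    intro ε hε
    filter_upwards [tendsto_one_div_add_atTop_nhds_zero_nat.eventually (gt_mem_nhds hε)]
      with n hn x
    rw [dist_eq_norm]
    exact (hφs n x).trans_lt hn
  · rw [Metric.tendstoUniformly_iff]
    intro ε hε
    filter_upwards [tendsto_one_div_add_atTop_nhds_zero_nat.eventually (gt_mem_nhds hε)]
      with n hn x
    rw [(hT n).fourier_eq, dist_zero_left]
    exact (hg n x).trans_lt hn
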